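/- Let $A$ be a finite set of agents and $\varphi\colon A\times A\to\{-1,1\}$ a qualification profile; $a$ qualifies $a'$ if $\varphi(a,a')=1$. For a start set $K_1\subseteq A$ let $K_i=\{a\in A\mid \exists a'\in K_{i-1}:\varphi(a',a)=1\}$ for $i\ge 2$. The liberal-start-respecting rule $f^{\mathrm{LSR}}$ starts with $K_1=\{a\mid\varphi(a,a)=1\}$, the consensus-start-respecting rule $f^{\mathrm{CSR}}$ with $K_1=\{a\mid\forall a'\in A:\varphi(a',a)=1\}$; in both cases $K_{i-1}\subseteq K_i$, and the set $f(A,\varphi)$ of socially qualified agents is the set $K_i$ at which the iteration becomes stationary. For a rule $f$, an instance of priced constructive link bribery consists of $A$, $\varphi$, a positive integer price $\rho(a,a')$ for every $(a,a')\in A\times A$, a set $A^+\subseteq A$ and a budget $\ell\in\mathbb N$. The question is whether there is a profile $\varphi'\colon A\times A\to\{-1,1\}$ with $A^+\subseteq f(A,\varphi')$ and $$\sum_{(a,a')\,:\,\varphi'(a,a')\ne\varphi(a,a')}\rho(a,a')\le\ell .$$ **Theorem.** For $f=f^{\mathrm{CSR}}$ and for $f=f^{\mathrm{LSR}}$, priced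 constructive link bribery is fixed-parameter tractable with respect to $|A^+|$: there are an algorithm (a program of a uniform-cost random access machine with addition, truncated subtraction and halving as its arithmetic operations), a computable function $g\colon\mathbb N\to\mathbb N$ and a constant $c$ such that the algorithm decides every instance $I$ in at most $g(|A^+|)\cdot|I|^{c}$ steps, where $|I|$ is the size of $I$ with all numbers written in binary. -/

import Mathlib

/-! ## Group identification and the iterative social rules -/

/-- A qualification profile on a set `A` of agents: `φ a b = true` means that `a` qualifies `b`
(value `1`), `φ a b = false` that `a` disqualifies `b` (value `-1`). -/
abbrev Profile (A : Type) := A → A → Bool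

/-- The stages of the iteration from the start set `K₁`: `stage φ K₁ i` is the set `K_{i+1}`,
with `K_{i+1} = {a | some a' ∈ K_i qualifies a}`. -/
def stage {A : Type} (φ : Profile A) (K₁ : Set A) : ℕ → Set A
  | 0 => K₁
  | i + 1 => {a | ∃ a' ∈ stage φ K₁ i, φ a' a = true}

/-- The result of the iteration. For the two start sets below the stages increase, so this union
is the stage at which the iteration becomes stationary; see `iterationResult_eq_stage` and
`exists_stage_eq_succ`. -/
def iterationResult {A : Type} (φ : Profile A) (K₁ : Set A) : Set A :=
  ⋃ i, stage φ K₁ i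

/-- The agents who qualify themselves. -/
def liberalStart {A : Type} (φ : Profile A) : Set A := {a | φ a a = true}

/-- The agents who are qualified by everyone, including themselves. -/
def consensusStart {A : Type} (φ : Profile A) : Set A := {a | ∀ a', φ a' a = true}

/-- The liberal-start-respecting rule. -/
def LSR {A : Type} (φ : Profile A) : Set A := iterationResult φ (liberalStart φ)

/-- The consensus-start-respecting rule. -/
def CSR {A : Type} (φ : Profile A) : Set A := iterationResult φ (consensusStart φ)

theorem consensusStart_subset {A : Type} (φ : Profile A) :
    consensusStart φ ⊆ liberalStart φ := fun a h => h a

theorem stage_monotone {A : Type} (φ : Profile A) (K₁ : Set A) (h : K₁ ⊆ liberalStart φ) :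
    Monotone (stage φ K₁) := by
  refine monotone_nat_of_le_succ fun i => ?_
  induction i with
  | zero => exact fun a ha => ⟨a, ha, h ha⟩
  | succ i ih => exact fun a ⟨b, hb, hba⟩ => ⟨b, ih hb, hba⟩

theorem exists_stage_eq_succ {A : Type} [Finite A] (φ : Profile A) (K₁ : Set A)
    (h : K₁ ⊆ liberalStart φ) : ∃ i, stage φ K₁ i = stage φ K₁ (i + 1) := by
  obtain ⟨i, hi⟩ := WellFoundedGT.monotone_chain_condition ⟨stage φ K₁, stage_monotone φ K₁ h⟩
  exact ⟨i, hi (i + 1) (Nat.le_succ i)⟩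

theorem iterationResult_eq_stage {A : Type} (φ : Profile A) (K₁ : Set A)
    (h : K₁ ⊆ liberalStart φ) (i : ℕ) (hi : stage φ K₁ i = stage φ K₁ (i + 1)) :
    iterationResult φ K₁ = stage φ K₁ i := by
  have key : ∀ j, stage φ K₁ (i + j) = stage φ K₁ i := by
    intro j
    induction j with
    | zero => rfl
    | succ j ih =>
      rw [hi]
      change {a | ∃ a' ∈ stage φ K₁ (i + j), φ a' a = true} = _
      rw [ih]
      rfl
  refine Set.Subset.antisymm (Set.iUnion_subset fun j => ?_) (Set.subset_iUnion _ i)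
  rw [← key j]
  exact stage_monotone φ K₁ h (Nat.le_add_left j i)

/-! ## Priced constructive link bribery -/

/-- An instance of priced constructive link bribery; the agents are the elements of `Fin n`. -/
structure LinkBriberyInstance where
  /-- number of agents -/
  n : ℕ
  /-- initial qualification profile -/
  φ : Profile (Fin n)
  /-- price of changing one qualification -/
  ρ : Fin n → Fin n → ℕ
  /-- prices are positive -/
  ρ_pos : ∀ a b, 0 < ρ a b
  /-- the set `A⁺` of agents that have to become socially qualified -/
  Aplus : Finset (Fin n)
  /-- the budget `ℓ` -/
  budget : ℕ

namespace LinkBriberyInstance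

/-- The cost of changing the given profile into `φ'`: the sum of the prices of all ordered pairs
whose qualification is modified. -/
def cost (I : LinkBriberyInstance) (φ' : Profile (Fin I.n)) : ℕ :=
  ∑ p : Fin I.n × Fin I.n, if φ' p.1 p.2 ≠ I.φ p.1 p.2 then I.ρ p.1 p.2 else 0

/-- Within the budget, the profile can be altered such that all agents of `A⁺` are socially
qualified under the rule `f`. -/
def IsYes (f : ∀ {A : Type}, Profile A → Set A) (I : LinkBriberyInstance) : Prop :=
  ∃ φ' : Profile (Fin I.n), I.cost φ' ≤ I.budget ∧ ∀ a ∈ I.Aplus, a ∈ f φ'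

/-- The encoding of an instance as a sequence of natural numbers: the number of agents, the
budget, the `0/1` matrix of the profile and the matrix of the prices (both row by row), and the
`0/1` indicator sequence of `A⁺`. -/
def encode (I : LinkBriberyInstance) : List ℕ :=
  [I.n, I.budget]
    ++ (List.ofFn fun i : Fin (I.n * I.n) => (I.φ i.divNat i.modNat).toNat)
    ++ (List.ofFn fun i : Fin (I.n * I.n) => I.ρ i.divNat i.modNat)
    ++ (List.ofFn fun a : Fin I.n => if a ∈ I.Aplus then 1 else 0)

theorem encode_injective : Function.Injective encode := by
  rintro ⟨n, φ, ρ, hρ, S, l⟩ ⟨n', φ', ρ', hρ', S', l'⟩ h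
  simp only [encode, List.cons_append, List.nil_append, List.cons.injEq] at h
  obtain ⟨rfl, rfl, h⟩ := h
  obtain ⟨h, hS⟩ := List.append_inj h (by simp)
  obtain ⟨hφ, hρe⟩ := List.append_inj h (by simp)
  rw [List.ofFn_inj] at hφ hρe hS
  have e1 : φ = φ' := by
    funext a b
    have := congrFun hφ (finProdFinEquiv (a, b))
    have e := finProdFinEquiv.symm_apply_apply (a, b)
    rw [finProdFinEquiv_symm_apply, Prod.mk.injEq] at e
    rw [e.1, e.2] at this
    revert this
    cases φ a b <;> cases φ' a b <;> simp
  have e2 : ρ = ρ' := by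
    funext a b
    have := congrFun hρe (finProdFinEquiv (a, b))
    have e := finProdFinEquiv.symm_apply_apply (a, b)
    rw [finProdFinEquiv_symm_apply, Prod.mk.injEq] at e
    rwa [e.1, e.2] at this
  have e3 : S = S' := by
    ext a
    have := congrFun hS a
    by_cases h1 : a ∈ S <;> by_cases h2 : a ∈ S' <;> simp_all
  subst e1 e2 e3
  rfl

end LinkBriberyInstance

/-! ## Random access machines

The usual random access machine with uniform cost: registers `R 0, R 1, …` that hold natural
numbers, a read-only sequence of natural numbers as input, indirect addressing, and addition,
truncated subtraction and halving as the only arithmetic operations. There is no multiplication,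
so running times agree with those of Turing machines up to a polynomial. -/

/-- The instructions of a random access machine. -/
inductive RAMInstr
  /-- `R r := input (R s)` -/
  | read (r s : ℕ)
  /-- `R r := c` -/
  | const (r c : ℕ)
  /-- `R r := R s + R t` -/
  | add (r s t : ℕ)
  /-- `R r := max (R s - R t) 0` -/
  | sub (r s t : ℕ)
  /-- `R r := ⌊R s / 2⌋` -/
  | half (r s : ℕ)
  /-- `R r := R (R s)` -/
  | load (r s : ℕ)
  /-- `R (R r) := R s` -/
  | store (r s : ℕ)
  /-- continue at instruction number `l` -/
  | jump (l : ℕ)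
  /-- continue at instruction number `l` if `R r = 0` -/
  | jumpZero (r l : ℕ)

/-- A configuration: the number of the next instruction and the contents of the registers. -/
structure RAMConfig where
  /-- program counter -/
  pc : ℕ
  /-- registers -/
  mem : ℕ → ℕ

namespace RAM

/-- At the start the first instruction is next and all registers hold `0`. -/
def init : RAMConfig := ⟨0, fun _ => 0⟩

/-- Execution of one instruction on input `x`; input positions are numbered from `0`, and reading
behind the end of the input gives `0`. -/
def exec (x : List ℕ) : RAMInstr → RAMConfig → RAMConfig
  | .read r s, ⟨pc, R⟩ => ⟨pc + 1, Function.update R r (x.getD (R s) 0)⟩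
  | .const r c, ⟨pc, R⟩ => ⟨pc + 1, Function.update R r c⟩
  | .add r s t, ⟨pc, R⟩ => ⟨pc + 1, Function.update R r (R s + R t)⟩
  | .sub r s t, ⟨pc, R⟩ => ⟨pc + 1, Function.update R r (R s - R t)⟩
  | .half r s, ⟨pc, R⟩ => ⟨pc + 1, Function.update R r (R s / 2)⟩
  | .load r s, ⟨pc, R⟩ => ⟨pc + 1, Function.update R r (R (R s))⟩
  | .store r s, ⟨pc, R⟩ => ⟨pc + 1, Function.update R (R r) (R s)⟩
  | .jump l, ⟨_, R⟩ => ⟨l, R⟩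
  | .jumpZero r l, ⟨pc, R⟩ => ⟨if R r = 0 then l else pc + 1, R⟩

/-- One step of the program `P` on input `x`. The machine has halted when the program counter does
not point to an instruction of `P`; a halted configuration does not change any more. -/
def step (P : List RAMInstr) (x : List ℕ) (c : RAMConfig) : RAMConfig :=
  match P[c.pc]? with
  | some i => exec x i c
  | none => c

/-- On input `x`, the program `P` halts after at most `t` steps with output `b` in register `0`. -/
def HaltsWithin (P : List RAMInstr) (x : List ℕ) (t b : ℕ) : Prop :=
  P.length ≤ ((step P x)^[t] init).pc ∧ ((step P x)^[t] init).mem 0 = b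

end RAM

/-- The size of an input: the total number of binary digits, plus one separator per number. -/
def inputSize (x : List ℕ) : ℕ := (x.map fun v => Nat.size v + 1).sum

/-! ## Fixed-parameter tractability -/

/-- A parameterized decision problem, given by its instances, their encoding as inputs of a random
access machine, the yes-instances, and the parameter. -/
structure ParamProblem where
  /-- instances -/
  Inst : Type
  /-- encoding of the instances -/
  encode : Inst → List ℕ
  /-- different instances have different encodings -/
  encode_injective : Function.Injective encode
  /-- the yes-instances -/
  IsYes : Inst → Prop
  /-- the parameter -/
  param : Inst → ℕ

/-- The problem is decided (output `1` for yes, `0` for no) by a random access machine in time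
`f k * |I| ^ c`, where `k` is the parameter and `|I|` the size of the instance, for some
computable function `f` and some constant `c`. -/
def FixedParameterTractable (Q : ParamProblem) : Prop :=
  ∃ (P : List RAMInstr) (f : ℕ → ℕ) (c : ℕ), Computable f ∧ ∀ I : Q.Inst,
    (Q.IsYes I →
      RAM.HaltsWithin P (Q.encode I) (f (Q.param I) * inputSize (Q.encode I) ^ c) 1) ∧
    (¬ Q.IsYes I →
      RAM.HaltsWithin P (Q.encode I) (f (Q.param I) * inputSize (Q.encode I) ^ c) 0)

/-- Priced constructive link bribery for the social rule `f`, parameterized by `|A⁺|`. -/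
def constructiveLinkBribery (f : ∀ {A : Type}, Profile A → Set A) : ParamProblem where
  Inst := LinkBriberyInstance
  encode := LinkBriberyInstance.encode
  encode_injective := LinkBriberyInstance.encode_injective
  IsYes := LinkBriberyInstance.IsYes f
  param I := I.Aplus.card

/-! Both rules are monotone in the positive qualifications, so only additions are useful and the
problem becomes a directed Steiner tree problem. Add a root: a link from the root to `a` makes `a` a
start agent, and a link from `u` to `a` makes `u` qualify `a`. Under a successful profile each
socially qualified agent has a link from the root or from an agent reached at an earlier stage
(`exists_forest`). All pairs needed for a link into `a` lie in the column of `a`, so with one link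
into each agent the costs are disjoint and the tree costs no more than the profile. Conversely,
joining two extensions of the profile along a link costs at most the sum of the three costs
(`Achieves.link`).

A cheapest tree is found by dynamic programming over vertices `u` and subsets `S` of `A⁺`: the entry
for `u` and `S ∪ S'` is lowered to the sum of the entries for `u, S` and `v, S'` and the cost of the
link from `u` to `v`. Entries within the budget are always realised by extensions (`Sound`), and `n`
rounds suffice because each round permits contracting an outermost agent of the tree into its parent
(`Progress.relaxed`). There are `n + 1` vertices and `2 ^ |A⁺|` masks, which gives the time bound.

To obtain a machine, the dynamic program is written in a small loop language whose compiled code is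
simulated step by step (`Cmd.steps_code`), in time polynomial in the largest loop limit. Arrays of
multiples replace multiplication. -/

/-! ## A loop language and its compilation to random access machines -/

namespace LoopLang

/-- The state of a loop program: scalar variables and five arrays. -/
structure State where
  /-- scalar variables -/
  v : ℕ → ℕ
  /-- arrays -/
  h : Fin 5 → ℕ → ℕ

namespace State

/-- Assignment to a scalar variable. -/
def set (s : State) (x a : ℕ) : State := ⟨Function.update s.v x a, s.h⟩

/-- Assignment to an array entry. -/
def put (s : State) (j : Fin 5) (i a : ℕ) : State :=
  ⟨s.v, Function.update s.h j (Function.update (s.h j) i a)⟩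

theorem set_v (s : State) (x a y : ℕ) : (s.set x a).v y = if y = x then a else s.v y := by
  simp [set, Function.update_apply]

@[simp] theorem set_h (s : State) (x a : ℕ) : (s.set x a).h = s.h := rfl

@[simp] theorem put_v (s : State) (j : Fin 5) (i a : ℕ) : (s.put j i a).v = s.v := rfl

theorem put_h (s : State) (j : Fin 5) (i a : ℕ) (j' : Fin 5) (i' : ℕ) :
    (s.put j i a).h j' i' = if j' = j ∧ i' = i then a else s.h j' i' := by
  by_cases hj : j' = j
  · subst hj
    simp [put, Function.update_apply]
  · simp [put, hj]

end State

/-- Expressions; `cond c a b` is `a` if `c ≠ 0` and `b` if `c = 0`. -/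
inductive Exp
  | lit (c : ℕ)
  | var (x : ℕ)
  | inp (e : Exp)
  | arr (j : Fin 5) (e : Exp)
  | add (a b : Exp)
  | sub (a b : Exp)
  | half (a : Exp)
  | cond (c a b : Exp)

/-- Commands; `loop x y c` executes `c` for `x = 0, …, y - 1`. -/
inductive Cmd
  | assign (x : ℕ) (e : Exp)
  | store (j : Fin 5) (i e : Exp)
  | seq (c d : Cmd)
  | loop (x y : ℕ) (c : Cmd)

/-- The value of an expression on input `inp`. -/
def Exp.eval (inp : List ℕ) (s : State) : Exp → ℕ
  | .lit c => c
  | .var x => s.v x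
  | .inp e => inp.getD (e.eval inp s) 0
  | .arr j e => s.h j (e.eval inp s)
  | .add a b => a.eval inp s + b.eval inp s
  | .sub a b => a.eval inp s - b.eval inp s
  | .half a => a.eval inp s / 2
  | .cond c a b => if c.eval inp s = 0 then b.eval inp s else a.eval inp s

/-- The first `n` passes through a loop with counter `x`. -/
def iter (f : State → State) (x : ℕ) (s : State) : ℕ → State
  | 0 => s
  | i + 1 => f ((iter f x s i).set x i)

/-- The effect of a command on input `inp`. -/
def Cmd.eval (inp : List ℕ) : Cmd → State → State
  | .assign x e, s => s.set x (e.eval inp s)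
  | .store j i e, s => s.put j (i.eval inp s) (e.eval inp s)
  | .seq c d, s => d.eval inp (c.eval inp s)
  | .loop x y c, s => (iter (c.eval inp) x s (s.v y)).set x (s.v y)

/-- The scalar variables that a command may change. -/
def Cmd.writes : Cmd → List ℕ
  | .assign x _ => [x]
  | .store _ _ _ => []
  | .seq c d => c.writes ++ d.writes
  | .loop x _ c => x :: c.writes

/-- The variables that serve as upper limits of loops. -/
def Cmd.bounds : Cmd → List ℕ
  | .assign _ _ => []
  | .store _ _ _ => []
  | .seq c d => c.bounds ++ d.bounds
  | .loop _ y c => y :: c.bounds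

/-- No loop changes its counter or its limit in its body. -/
def Cmd.WF : Cmd → Prop
  | .assign _ _ => True
  | .store _ _ _ => True
  | .seq c d => c.WF ∧ d.WF
  | .loop x y c => c.WF ∧ x ∉ c.writes ∧ y ∉ c.writes ∧ x ≠ y

instance Cmd.decidableWF : (c : Cmd) → Decidable c.WF
  | .assign _ _ => inferInstanceAs (Decidable True)
  | .store _ _ _ => inferInstanceAs (Decidable True)
  | .seq c d => have := c.decidableWF; have := d.decidableWF
    inferInstanceAs (Decidable (c.WF ∧ d.WF))
  | .loop x y c => have := c.decidableWF
    inferInstanceAs (Decidable (c.WF ∧ x ∉ c.writes ∧ y ∉ c.writes ∧ x ≠ y))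

theorem Cmd.eval_v_of_notMem_writes (inp : List ℕ) (c : Cmd) (s : State) (z : ℕ)
    (hz : z ∉ c.writes) : (c.eval inp s).v z = s.v z := by
  induction c generalizing s with
  | assign x e =>
    simp only [writes, List.mem_singleton] at hz
    simp [eval, State.set_v, hz]
  | store j i e => simp [eval]
  | seq c d ihc ihd =>
    simp only [writes, List.mem_append, not_or] at hz
    rw [eval, ihd _ hz.2, ihc _ hz.1]
  | loop x y c ih =>
    simp only [writes, List.mem_cons, not_or] at hz
    rw [eval, State.set_v, if_neg hz.1]
    induction s.v y with
    | zero => rfl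
    | succ i ihi => rw [iter, ih _ hz.2, State.set_v, if_neg hz.1, ihi]

/-- The arrays that a command may change. -/
def Cmd.stores : Cmd → List (Fin 5)
  | .assign _ _ => []
  | .store j _ _ => [j]
  | .seq c d => c.stores ++ d.stores
  | .loop _ _ c => c.stores

theorem Cmd.eval_h_of_notMem_stores (inp : List ℕ) (c : Cmd) (s : State) (j : Fin 5)
    (hj : j ∉ c.stores) : (c.eval inp s).h j = s.h j := by
  induction c generalizing s with
  | assign x e => simp [eval]
  | store j' i e =>
    simp only [stores, List.mem_singleton] at hj
    simp [eval, State.put, hj]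
  | seq c d ihc ihd =>
    simp only [stores, List.mem_append, not_or] at hj
    rw [eval, ihd _ hj.2, ihc _ hj.1]
  | loop x y c ih =>
    rw [eval, State.set_h]
    induction s.v y with
    | zero => rfl
    | succ i ihi => rw [iter, ih _ hj, State.set_h, ihi]

/-- The invariant rule for loops. -/
theorem Cmd.eval_loop_induction (inp : List ℕ) (x y : ℕ) (c : Cmd) (s : State)
    (p : ℕ → State → Prop) (h0 : p 0 s)
    (hs : ∀ i < s.v y, ∀ t, p i t → p (i + 1) (c.eval inp (t.set x i)))
    (hx : ∀ t, p (s.v y) t → p (s.v y) (t.set x (s.v y))) :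
    p (s.v y) ((Cmd.loop x y c).eval inp s) := by
  -- Evaluation ends by assigning the limit to the counter, the value that the compiled loop leaves
  -- there.
  refine hx _ ?_
  have key : ∀ i ≤ s.v y, p i (iter (c.eval inp) x s i) := by
    intro i
    induction i with
    | zero => exact fun _ => h0
    | succ i ih => exact fun hi => hs i hi _ (ih (Nat.le_of_succ_le hi))
  exact key _ le_rfl

/-! ### Compilation -/

/-- The register that holds the result of an expression at nesting depth `d`. -/
abbrev tmp (d : ℕ) : ℕ := 8 * d + 1

/-- Instructions that turn an array index in `tmp d` into the address of the entry. -/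
def address (j : Fin 5) (d : ℕ) : List RAMInstr :=
  -- Three doublings multiply the index by `8`. Modulo `8`, scalars occupy residue `0`, temporaries
  -- residue `1`, and the arrays residues `2` to `6`.
  [.add (tmp d) (tmp d) (tmp d), .add (tmp d) (tmp d) (tmp d), .add (tmp d) (tmp d) (tmp d),
    .const (tmp (d + 1)) (j + 2), .add (tmp d) (tmp d) (tmp (d + 1))]

/-- The length of the code of an expression. -/
def Exp.len : Exp → ℕ
  | .lit _ => 1
  | .var _ => 2
  | .inp e => e.len + 1
  | .arr _ e => e.len + 6
  | .add a b => a.len + b.len + 1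
  | .sub a b => a.len + b.len + 1
  | .half a => a.len + 1
  | .cond c a b => c.len + 1 + a.len + 1 + b.len

/-- The code of an expression, to be placed at position `off`, with result in `tmp d`. -/
def Exp.code : Exp → (d off : ℕ) → List RAMInstr
  | .lit c, d, _ => [.const (tmp d) c]
  | .var x, d, _ => [.const (tmp d) 0, .add (tmp d) (8 * x) (tmp d)]
  | .inp e, d, off => e.code d off ++ [.read (tmp d) (tmp d)]
  | .arr j e, d, off => e.code d off ++ (address j d ++ [.load (tmp d) (tmp d)])
  | .add a b, d, off =>
    a.code d off ++ (b.code (d + 1) (off + a.len) ++ [.add (tmp d) (tmp d) (tmp (d + 1))])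
  | .sub a b, d, off =>
    a.code d off ++ (b.code (d + 1) (off + a.len) ++ [.sub (tmp d) (tmp d) (tmp (d + 1))])
  | .half a, d, off => a.code d off ++ [.half (tmp d) (tmp d)]
  | .cond c a b, d, off =>
    c.code d off ++ (.jumpZero (tmp d) (off + c.len + 1 + a.len + 1) ::
      (a.code d (off + c.len + 1) ++ (.jump (off + c.len + 1 + a.len + 1 + b.len) ::
        b.code d (off + c.len + 1 + a.len + 1))))

/-- The length of the code of a command. -/
def Cmd.len : Cmd → ℕ
  | .assign _ e => e.len + 2
  | .store _ i e => i.len + 5 + e.len + 1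
  | .seq c d => c.len + d.len
  | .loop _ _ c => 3 + c.len + 3

/-- The code of a command, to be placed at position `off`. -/
def Cmd.code : Cmd → (off : ℕ) → List RAMInstr
  | .assign x e, off => e.code 0 off ++ [.const (tmp 1) 0, .add (8 * x) (tmp 0) (tmp 1)]
  | .store j i e, off =>
    i.code 0 off ++ (address j 0 ++ (e.code 1 (off + i.len + 5) ++ [.store (tmp 0) (tmp 1)]))
  | .seq c d, off => c.code off ++ d.code (off + c.len)
  | .loop x y c, off =>
    -- The code reads the limit anew before each pass, whereas the semantics fixes it at entry;
    -- `Cmd.WF` makes the two agree.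
    .const (8 * x) 0 :: .sub (tmp 0) (8 * y) (8 * x) ::
      .jumpZero (tmp 0) (off + 3 + c.len + 3) ::
        (c.code (off + 3) ++
          [.const (tmp 0) 1, .add (8 * x) (8 * x) (tmp 0), .jump (off + 1)])

@[simp] theorem Exp.length_code (e : Exp) (d off : ℕ) : (e.code d off).length = e.len := by
  induction e generalizing d off <;> simp_all [code, len, address] <;> omega

@[simp] theorem Cmd.length_code (c : Cmd) (off : ℕ) : (c.code off).length = c.len := by
  induction c generalizing off <;> simp_all [code, len, address] <;> omega

/-- The code `L` is found in the program `P` from position `off` on. -/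
def CodeAt (P : List RAMInstr) (off : ℕ) (L : List RAMInstr) : Prop :=
  ∀ i < L.length, P[off + i]? = L[i]?

theorem codeAt_append {P : List RAMInstr} {off : ℕ} {L L' : List RAMInstr} :
    CodeAt P off (L ++ L') ↔ CodeAt P off L ∧ CodeAt P (off + L.length) L' := by
  constructor
  · refine fun h => ⟨fun i hi => ?_, fun i hi => ?_⟩
    · rw [h i (by simp; omega), List.getElem?_append_left hi]
    · rw [add_assoc, h _ (by simpa using hi), List.getElem?_append_right (by omega)]
      simp
  · rintro ⟨h, h'⟩ i hi
    by_cases hL : i < L.length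
    · rw [h i hL, List.getElem?_append_left hL]
    · rw [List.getElem?_append_right (by omega), ← h' (i - L.length) (by simp at hi; omega)]
      congr 1
      omega

theorem codeAt_cons {P : List RAMInstr} {off : ℕ} {i : RAMInstr} {L : List RAMInstr} :
    CodeAt P off (i :: L) ↔ P[off]? = some i ∧ CodeAt P (off + 1) L := by
  rw [← List.singleton_append, codeAt_append]
  simp [CodeAt]

/-! ### Runs of the machine and their composition. -/

/-- The machine gets from `c` to `c'` in at most `T` steps. -/
def Steps (P : List RAMInstr) (inp : List ℕ) (T : ℕ) (c c' : RAMConfig) : Prop :=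
  ∃ t ≤ T, (RAM.step P inp)^[t] c = c'

section Steps

variable {P : List RAMInstr} {inp : List ℕ}

theorem Steps.refl (c : RAMConfig) : Steps P inp 0 c c := ⟨0, le_rfl, rfl⟩

theorem Steps.trans {T T' : ℕ} {c c' c'' : RAMConfig} (h : Steps P inp T c c')
    (h' : Steps P inp T' c' c'') : Steps P inp (T + T') c c'' := by
  obtain ⟨t, ht, rfl⟩ := h
  obtain ⟨t', ht', rfl⟩ := h'
  exact ⟨t' + t, by omega, by rw [Function.iterate_add_apply]⟩

theorem Steps.mono {T T' : ℕ} {c c' : RAMConfig} (h : Steps P inp T c c') (hT : T ≤ T') :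
    Steps P inp T' c c' := by
  obtain ⟨t, ht, e⟩ := h
  exact ⟨t, ht.trans hT, e⟩

theorem Steps.single {i : RAMInstr} {pc : ℕ} {m : ℕ → ℕ} (h : P[pc]? = some i) :
    Steps P inp 1 ⟨pc, m⟩ (RAM.exec inp i ⟨pc, m⟩) :=
  ⟨1, le_rfl, by simp [RAM.step, h]⟩

theorem Steps.cons {T : ℕ} {i : RAMInstr} {pc : ℕ} {m : ℕ → ℕ} {c : RAMConfig}
    (h : P[pc]? = some i) (h' : Steps P inp T (RAM.exec inp i ⟨pc, m⟩) c) :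
    Steps P inp (T + 1) ⟨pc, m⟩ c :=
  ((Steps.single h).trans h').mono (by omega)

end Steps

/-! ### Correctness and running time of compiled code. -/

/-- The registers `m` represent the state `s`. -/
def Rel (s : State) (m : ℕ → ℕ) : Prop :=
  (∀ x, m (8 * x) = s.v x) ∧ ∀ (j : Fin 5) i, m (8 * i + (j + 2)) = s.h j i

/-- The registers `m` and `m'` differ at most in `tmp d, tmp (d + 1), …`. -/
def Frame (d : ℕ) (m m' : ℕ → ℕ) : Prop :=
  ∀ r, (∀ d' ≥ d, r ≠ tmp d') → m' r = m r

theorem Frame.refl (d : ℕ) (m : ℕ → ℕ) : Frame d m m := fun _ _ => rfl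

theorem Frame.trans {d d' : ℕ} {m m' m'' : ℕ → ℕ} (h : Frame d m m') (h' : Frame d' m' m'')
    (hd : d ≤ d') : Frame d m m'' := fun r hr =>
  (h' r fun e he => hr e (hd.trans he)).trans (h r hr)

theorem Frame.update {d d' : ℕ} {m m' : ℕ → ℕ} (h : Frame d m m') (a : ℕ) (hd : d ≤ d') :
    Frame d m (Function.update m' (tmp d') a) := fun r hr => by
  rw [Function.update_of_ne (hr d' hd), h r hr]

theorem Rel.of_frame {d : ℕ} {s : State} {m m' : ℕ → ℕ} (h : Rel s m) (hf : Frame d m m') :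
    Rel s m' := by
  refine ⟨fun x => ?_, fun j i => ?_⟩
  · rw [hf _ fun d' _ => by simp only [tmp]; omega, h.1]
  · rw [hf _ fun d' _ => by have := j.2; simp only [tmp]; omega, h.2]

theorem Rel.set {s : State} {m : ℕ → ℕ} (h : Rel s m) (x a : ℕ) :
    Rel (s.set x a) (Function.update m (8 * x) a) := by
  refine ⟨fun y => ?_, fun j i => ?_⟩
  · simp [Function.update_apply, State.set_v, h.1]
  · rw [Function.update_of_ne (by have := j.2; omega), h.2]
    rfl

theorem Rel.put {s : State} {m : ℕ → ℕ} (h : Rel s m) (j : Fin 5) (i a : ℕ) :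
    Rel (s.put j i a) (Function.update m (8 * i + (j + 2)) a) := by
  refine ⟨fun y => ?_, fun j' i' => ?_⟩
  · rw [Function.update_of_ne (by have := j.2; omega), h.1]
    rfl
  · rw [State.put_h, Function.update_apply]
    have := j.2
    have := j'.2
    simp only [h.2, Fin.ext_iff]
    congr 1
    simp only [eq_iff_iff]
    omega

theorem steps_address {P : List RAMInstr} {inp : List ℕ} (j : Fin 5) {d off : ℕ} {m : ℕ → ℕ}
    (hc : CodeAt P off (address j d)) :
    ∃ m', Steps P inp 5 ⟨off, m⟩ ⟨off + 5, m'⟩ ∧ m' (tmp d) = 8 * m (tmp d) + (j + 2) ∧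
      Frame d m m' := by
  simp only [address, codeAt_cons] at hc
  obtain ⟨h1, h2, h3, h4, h5, -⟩ := hc
  refine ⟨_, .cons h1 <| .cons h2 <| .cons h3 <| .cons h4 <| .cons h5 <| .refl _, ?_, ?_⟩
  · simp
    omega
  · exact ((((((Frame.refl d m).update _ le_rfl).update _ le_rfl).update _ le_rfl).update _
      (Nat.le_succ d))).update _ le_rfl

/-- Code at depth `d` disturbs only temporaries of depth at least `d`. Hence a left operand in `tmp
d` survives the evaluation of the right operand at depth `d + 1`. -/
theorem Exp.steps_code {P : List RAMInstr} {inp : List ℕ} (s : State) (e : Exp) :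
    ∀ {d off : ℕ} {m : ℕ → ℕ}, CodeAt P off (e.code d off) → Rel s m →
      ∃ m', Steps P inp e.len ⟨off, m⟩ ⟨off + e.len, m'⟩ ∧ m' (tmp d) = e.eval inp s ∧
        Frame d m m' := by
  induction e with
  | lit c =>
    intro d off m hc hm
    simp only [code, codeAt_cons] at hc
    exact ⟨_, .cons hc.1 <| .refl _, by simp [eval], (Frame.refl d m).update _ le_rfl⟩
  | var x =>
    intro d off m hc hm
    simp only [code, codeAt_cons] at hc
    refine ⟨_, .cons hc.1 <| .cons hc.2.1 <| .refl _, ?_,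
      ((Frame.refl d m).update _ le_rfl).update _ le_rfl⟩
    have : 8 * x ≠ 8 * d + 1 := by omega
    simp [eval, this, hm.1]
  | inp e ih =>
    intro d off m hc hm
    simp only [code, codeAt_append, codeAt_cons, length_code] at hc
    obtain ⟨m', h1, h2, h3⟩ := ih hc.1 hm
    exact ⟨_, h1.trans (.single hc.2.1), by simp [h2, eval], h3.update _ le_rfl⟩
  | half e ih =>
    intro d off m hc hm
    simp only [code, codeAt_append, codeAt_cons, length_code] at hc
    obtain ⟨m', h1, h2, h3⟩ := ih hc.1 hm
    exact ⟨_, h1.trans (.single hc.2.1), by simp [h2, eval], h3.update _ le_rfl⟩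
  | arr j e ih =>
    intro d off m hc hm
    simp only [code, codeAt_append, codeAt_cons, length_code] at hc
    obtain ⟨m', h1, h2, h3⟩ := ih hc.1 hm
    obtain ⟨m'', h1', h2', h3'⟩ := steps_address j hc.2.1
    have h3'' := h3.trans h3' le_rfl
    refine ⟨_, (h1.trans h1').trans (.single hc.2.2.1), ?_, h3''.update _ le_rfl⟩
    simp only [Function.update_self, h2', h2, eval]
    exact (hm.of_frame h3'').2 j _
  | add a b iha ihb =>
    intro d off m hc hm
    simp only [code, codeAt_append, codeAt_cons, length_code] at hc
    obtain ⟨m', h1, h2, h3⟩ := iha hc.1 hm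
    obtain ⟨m'', h1', h2', h3'⟩ := ihb hc.2.1 (hm.of_frame h3)
    have hd : m'' (tmp d) = m' (tmp d) := h3' _ fun d' hd' => by simp only [tmp]; omega
    have := (h1.trans h1').trans (.single hc.2.2.1)
    rw [show off + a.len + b.len = off + (a.len + b.len) by omega] at this
    exact ⟨_, this, by simp [eval, hd, h2, h2'],
      (h3.trans h3' (Nat.le_succ d)).update _ le_rfl⟩
  | sub a b iha ihb =>
    intro d off m hc hm
    simp only [code, codeAt_append, codeAt_cons, length_code] at hc
    obtain ⟨m', h1, h2, h3⟩ := iha hc.1 hm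
    obtain ⟨m'', h1', h2', h3'⟩ := ihb hc.2.1 (hm.of_frame h3)
    have hd : m'' (tmp d) = m' (tmp d) := h3' _ fun d' hd' => by simp only [tmp]; omega
    have := (h1.trans h1').trans (.single hc.2.2.1)
    rw [show off + a.len + b.len = off + (a.len + b.len) by omega] at this
    exact ⟨_, this, by simp [eval, hd, h2, h2'],
      (h3.trans h3' (Nat.le_succ d)).update _ le_rfl⟩
  | cond c a b ihc iha ihb =>
    intro d off m hc hm
    simp only [code, codeAt_append, codeAt_cons, length_code] at hc
    obtain ⟨hc1, hc2, hc3, hc4, hc5⟩ := hc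
    obtain ⟨m', h1, h2, h3⟩ := ihc hc1 hm
    have hj := h1.trans (.single hc2)
    simp only [RAM.exec, h2] at hj
    by_cases h0 : c.eval inp s = 0
    · obtain ⟨m'', h1', h2', h3'⟩ := ihb hc5 (hm.of_frame h3)
      rw [if_pos h0] at hj
      have := (hj.trans h1').mono (T' := (cond c a b).len) (by simp only [len]; omega)
      refine ⟨m'', ?_, by simp [eval, h0, h2'], h3.trans h3' le_rfl⟩
      simpa only [len, add_assoc] using this
    · obtain ⟨m'', h1', h2', h3'⟩ := iha hc3 (hm.of_frame h3)
      rw [if_neg h0] at hj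
      have := ((hj.trans h1').trans (.single hc4)).mono (T' := (cond c a b).len)
        (by simp only [len]; omega)
      refine ⟨m'', ?_, by simp [eval, h0, h2'], h3.trans h3' le_rfl⟩
      simpa only [len, RAM.exec, add_assoc] using this

/-- A bound on the number of steps, if the loop limits are at most `M`. -/
def Cmd.cost (M : ℕ) : Cmd → ℕ
  | .assign _ e => e.len + 2
  | .store _ i e => i.len + 5 + e.len + 1
  | .seq c d => c.cost M + d.cost M
  | .loop _ _ c => M * (c.cost M + 5) + 3

/-- The leading coefficient of a polynomial bound for `Cmd.cost`. -/
def Cmd.coeff : Cmd → ℕ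
  | .assign _ e => e.len + 2
  | .store _ i e => i.len + 5 + e.len + 1
  | .seq c d => c.coeff + d.coeff
  | .loop _ _ c => c.coeff + 8

/-- The degree of a polynomial bound for `Cmd.cost`. -/
def Cmd.deg : Cmd → ℕ
  | .assign _ _ => 0
  | .store _ _ _ => 0
  | .seq c d => c.deg + d.deg
  | .loop _ _ c => c.deg + 1

/-- The summand `8` in `Cmd.coeff` covers the five control instructions of each pass and the three
for entering and leaving a loop. -/
theorem Cmd.cost_le (M : ℕ) (c : Cmd) : c.cost M ≤ c.coeff * (M + 1) ^ c.deg := by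
  induction c with
  | assign x e => simp [cost, coeff, deg]
  | store j i e => simp [cost, coeff, deg]
  | seq c d ihc ihd =>
    simp only [cost, coeff, deg, add_mul]
    refine add_le_add (ihc.trans ?_) (ihd.trans ?_)
    · exact Nat.mul_le_mul_left _ (Nat.pow_le_pow_right (Nat.succ_pos M) (by omega))
    · exact Nat.mul_le_mul_left _ (Nat.pow_le_pow_right (Nat.succ_pos M) (by omega))
  | loop x y c ih =>
    have h1 : 1 ≤ (M + 1) ^ c.deg := Nat.one_le_pow _ _ (Nat.succ_pos M)
    simp only [cost, coeff, deg, pow_succ]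
    calc M * (c.cost M + 5) + 3
        ≤ M * (c.coeff * (M + 1) ^ c.deg + 5 * (M + 1) ^ c.deg) + 3 * (M + 1) ^ c.deg := by
          gcongr <;> omega
      _ ≤ (c.coeff + 8) * ((M + 1) ^ c.deg * (M + 1)) := by
          nlinarith [Nat.zero_le (c.coeff * (M + 1) ^ c.deg), Nat.zero_le (M * (M + 1) ^ c.deg)]

/-- As no loop limit is written anywhere in `c`, the bound `M` on the initial values holds
throughout the run. -/
theorem Cmd.steps_code {P : List RAMInstr} {inp : List ℕ} {M : ℕ} (c : Cmd) :
    ∀ {off : ℕ} {s : State} {m : ℕ → ℕ}, c.WF → (∀ y ∈ c.bounds, y ∉ c.writes ∧ s.v y ≤ M) →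
      CodeAt P off (c.code off) → Rel s m →
      ∃ m', Steps P inp (c.cost M) ⟨off, m⟩ ⟨off + c.len, m'⟩ ∧ Rel (c.eval inp s) m' := by
  induction c with
  | assign x e =>
    intro off s m _ _ hc hm
    simp only [code, codeAt_append, codeAt_cons, Exp.length_code] at hc
    obtain ⟨m', h1, h2, h3⟩ := e.steps_code s hc.1 hm
    refine ⟨_, h1.trans (.cons hc.2.1 <| .single hc.2.2.1), ?_⟩
    have := ((hm.of_frame h3).of_frame ((Frame.refl 1 m').update 0 le_rfl)).set x
      (e.eval inp s)
    simpa [h2, eval] using this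
  | store j i e =>
    intro off s m _ _ hc hm
    simp only [code, codeAt_append, codeAt_cons, Exp.length_code] at hc
    obtain ⟨hc1, hc2, hc3, hc4, -⟩ := hc
    obtain ⟨m1, h1, h2, h3⟩ := i.steps_code s hc1 hm
    obtain ⟨m2, h4, h5, h6⟩ := steps_address (inp := inp) j hc2
    have hm2 := (hm.of_frame h3).of_frame h6
    obtain ⟨m3, h7, h8, h9⟩ := e.steps_code s hc3 hm2
    have hd : m3 (tmp 0) = m2 (tmp 0) := h9 _ fun d' hd' => by simp only [tmp]; omega
    have h10 := ((h1.trans h4).trans h7).trans (.single hc4)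
    refine ⟨Function.update m3 (m3 (tmp 0)) (m3 (tmp 1)),
      by simpa [len, cost, address, RAM.exec, add_assoc] using h10, ?_⟩
    have := (hm2.of_frame h9).put j (i.eval inp s) (e.eval inp s)
    simpa [hd, h8, h5, h2, eval] using this
  | seq c d ihc ihd =>
    intro off s m hw hb hc hm
    simp only [code, codeAt_append, length_code] at hc
    simp only [bounds, writes, List.mem_append, not_or] at hb
    obtain ⟨m1, h1, h2⟩ := ihc hw.1 (fun y hy => ⟨(hb y (.inl hy)).1.1, (hb y (.inl hy)).2⟩)
      hc.1 hm
    obtain ⟨m2, h3, h4⟩ := ihd (s := c.eval inp s) hw.2 (fun y hy => ⟨(hb y (.inr hy)).1.2, by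
      rw [eval_v_of_notMem_writes _ _ _ _ (hb y (.inr hy)).1.1]; exact (hb y (.inr hy)).2⟩)
      hc.2 h2
    refine ⟨m2, ?_, h4⟩
    simpa only [len, cost, add_assoc] using h1.trans h3
  | loop x y c ih =>
    intro off s m hw hb hc hm
    simp only [code, codeAt_append, codeAt_cons, length_code] at hc
    obtain ⟨hc1, hc2, hc3, hc4, hc5, hc6, hc7, -⟩ := hc
    obtain ⟨hw1, hw2, hw3, hw4⟩ := hw
    simp only [bounds, writes, List.mem_cons, not_or] at hb
    -- `S i` is the state at the test before pass `i`, with the counter already equal to `i`; `S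
    -- (s.v y)` is the final state.
    set S : ℕ → State := fun i => (iter (c.eval inp) x s i).set x i with hS
    have hSv : ∀ i z, z ≠ x → z ∉ c.writes → (S i).v z = s.v z := by
      intro i z hz hz'
      rw [hS]
      simp only [State.set_v, if_neg hz]
      induction i with
      | zero => rfl
      | succ i ihi =>
        rw [iter, eval_v_of_notMem_writes _ _ _ _ hz', State.set_v, if_neg hz, ihi]
    have hSx : ∀ i, (S i).v x = i := fun i => by simp [hS, State.set_v]
    have key : ∀ i ≤ s.v y, ∃ m', Steps P inp (i * (c.cost M + 5) + 1) ⟨off, m⟩ ⟨off + 1, m'⟩ ∧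
        Rel (S i) m' := by
      intro i
      induction i with
      | zero =>
        intro _
        refine ⟨_, (Steps.single hc1).mono (by omega), ?_⟩
        exact hm.set x 0
      | succ i ihi =>
        intro hi
        obtain ⟨m1, h1, h2⟩ := ihi (by omega)
        have h3 := (h1.trans (.single hc2)).trans (.single hc3)
        have hne : m1 (8 * y) - m1 (8 * x) ≠ 0 := by
          rw [h2.1, h2.1, hSx, hSv i y (Ne.symm hw4) hw3]
          omega
        simp only [RAM.exec, Function.update_self, if_neg hne] at h3
        have h2' := h2.of_frame ((Frame.refl 0 m1).update (m1 (8 * y) - m1 (8 * x)) le_rfl)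
        obtain ⟨m2, h4, h5⟩ := ih (s := S i) hw1 (fun z hz => ⟨(hb z (.inr hz)).1.2, by
          rw [hSv i z (hb z (.inr hz)).1.1 (hb z (.inr hz)).1.2]; exact (hb z (.inr hz)).2⟩)
          hc4 h2'
        have h6 := ((h3.trans h4).trans (.single hc5)).trans (.cons hc6 <| .single hc7)
        refine ⟨_, h6.mono (by ring_nf; omega), ?_⟩
        have h7 := (h5.of_frame ((Frame.refl 0 m2).update 1 le_rfl)).set x (i + 1)
        have hx : m2 (8 * x) = i := by
          rw [h5.1, eval_v_of_notMem_writes _ _ _ _ hw2, hSx]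
        have e : 8 * x ≠ tmp 0 := by simp only [tmp]; omega
        simpa [Function.update_of_ne e, hx, hS, iter] using h7
    obtain ⟨m1, h1, h2⟩ := key _ le_rfl
    have h3 := (h1.trans (.single hc2)).trans (.single hc3)
    have he : m1 (8 * y) - m1 (8 * x) = 0 := by
      rw [h2.1, h2.1, hSx, hSv _ y (Ne.symm hw4) hw3]
      omega
    simp only [RAM.exec, Function.update_self, if_pos he] at h3
    refine ⟨Function.update m1 (tmp 0) (m1 (8 * y) - m1 (8 * x)), ?_,
      h2.of_frame ((Frame.refl 0 m1).update _ le_rfl)⟩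
    have hM : s.v y * (c.cost M + 5) ≤ M * (c.cost M + 5) :=
      Nat.mul_le_mul_right _ (hb y (.inl rfl)).2
    have := h3.mono (T' := M * (c.cost M + 5) + 3) (by omega)
    simpa only [len, cost, add_assoc] using this

/-- On input `inp`, the code of `c` takes registers that represent `s` in at most `T` steps to
registers that represent the result of `c`. -/
def Cmd.Runs (inp : List ℕ) (T : ℕ) (c : Cmd) (s : State) : Prop :=
  ∀ ⦃P : List RAMInstr⦄ ⦃off : ℕ⦄ ⦃m : ℕ → ℕ⦄, CodeAt P off (c.code off) → Rel s m →
    ∃ m', Steps P inp T ⟨off, m⟩ ⟨off + c.len, m'⟩ ∧ Rel (c.eval inp s) m'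

/-- Stages are timed separately: an earlier stage may compute the loop limits of a later one, and
then `Cmd.steps_code` does not apply to the whole. -/
theorem Cmd.Runs.seq {inp : List ℕ} {T T' : ℕ} {c d : Cmd} {s : State} (h : c.Runs inp T s)
    (h' : d.Runs inp T' (c.eval inp s)) : (Cmd.seq c d).Runs inp (T + T') s := by
  intro P off m hc hm
  simp only [code, codeAt_append, length_code] at hc
  obtain ⟨m1, h1, h2⟩ := h hc.1 hm
  obtain ⟨m2, h3, h4⟩ := h' hc.2 h2
  exact ⟨m2, by simpa only [len, add_assoc] using h1.trans h3, h4⟩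

theorem Cmd.runs {inp : List ℕ} {M : ℕ} {c : Cmd} {s : State} (hw : c.WF)
    (hb : ∀ y ∈ c.bounds, y ∉ c.writes) (hM : ∀ y ∈ c.bounds, s.v y ≤ M) :
    c.Runs inp (c.coeff * (M + 1) ^ c.deg) s := fun P off m hc hm => by
  obtain ⟨m', h1, h2⟩ := c.steps_code (inp := inp) hw (fun y hy => ⟨hb y hy, hM y hy⟩) hc hm
  exact ⟨m', h1.mono (c.cost_le M), h2⟩

/-- The state in which all variables and array entries are `0`. -/
def State.zero : State := ⟨fun _ => 0, fun _ _ => 0⟩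

theorem Cmd.Runs.haltsWithin {inp : List ℕ} {T : ℕ} {c : Cmd} (h : c.Runs inp T State.zero) :
    RAM.HaltsWithin (c.code 0) inp T ((c.eval inp State.zero).v 0) := by
  have hc : CodeAt (c.code 0) 0 (c.code 0) := fun i _ => by rw [zero_add]
  obtain ⟨m, ⟨t, ht, e⟩, hm⟩ := h hc (m := fun _ => 0) ⟨fun _ => rfl, fun _ _ => rfl⟩
  -- The machine has halted here, so the run can be prolonged to exactly `T` steps.
  have hfix : RAM.step (c.code 0) inp ⟨0 + c.len, m⟩ = ⟨0 + c.len, m⟩ := by simp [RAM.step]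
  have : (RAM.step (c.code 0) inp)^[T] RAM.init = ⟨0 + c.len, m⟩ := by
    rw [← Nat.sub_add_cancel ht, Function.iterate_add_apply, RAM.init, e,
      Function.iterate_fixed hfix]
  rw [RAM.HaltsWithin, this, ← hm.1 0]
  simp

end LoopLang

/-! ## Combinatorics of the bribery problem -/

/-- The pairs whose qualification makes `a` a start agent: `(a, a)` for the liberal start set
(`lib = true`) and all pairs `(b, a)` for the consensus start set (`lib = false`). -/
def StartPair {A : Type} (lib : Bool) (b a : A) : Prop := lib = true → b = a

/-- The liberal-start-respecting rule for `lib = true`, and the consensus-start-respecting rule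
for `lib = false`. -/
def startRule (lib : Bool) {A : Type} (φ : Profile A) : Set A :=
  iterationResult φ {a | ∀ b, StartPair lib b a → φ b a = true}

theorem startRule_true {A : Type} (φ : Profile A) : startRule true φ = LSR φ := by
  simp [startRule, LSR, StartPair, liberalStart]

theorem startRule_false {A : Type} (φ : Profile A) : startRule false φ = CSR φ := by
  simp [startRule, CSR, StartPair, consensusStart]

theorem mem_iterationResult_of_rel {A : Type} {φ : Profile A} {K : Set A} {a b : A}
    (ha : a ∈ iterationResult φ K) (hab : φ a b = true) : b ∈ iterationResult φ K := by
  obtain ⟨i, hi⟩ := Set.mem_iUnion.1 ha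
  exact Set.mem_iUnion.2 ⟨i + 1, a, hi, hab⟩

namespace LinkBriberyInstance

variable (I : LinkBriberyInstance) (lib : Bool)

/-! ### Ranks and bit masks of subsets of `A⁺`. -/

/-- The number of agents of `A⁺` before position `i`. -/
def rank (i : ℕ) : ℕ := (I.Aplus.filter fun a => a.val < i).card

theorem rank_zero : I.rank 0 = 0 := by simp [rank]

theorem rank_n : I.rank I.n = I.Aplus.card := by simp [rank]

theorem rank_mono : Monotone I.rank := fun _ _ h =>
  Finset.card_le_card (Finset.monotone_filter_right _ fun _ _ ha => lt_of_lt_of_le ha h)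

/-- This recursion lets the program compute all masks in one pass over the agents. -/
theorem rank_succ (a : Fin I.n) :
    I.rank (a + 1) = I.rank a + if a ∈ I.Aplus then 1 else 0 := by
  have : (I.Aplus.filter fun b => b.val < a.val + 1) =
      (I.Aplus.filter fun b => b.val < a.val) ∪ I.Aplus.filter fun b => b = a := by
    rw [← Finset.filter_or]
    refine Finset.filter_congr fun b _ => ?_
    rw [Fin.ext_iff]
    omega
  rw [rank, this, Finset.card_union_of_disjoint, Finset.filter_eq']
  · split_ifs <;> simp [rank]
  · refine Finset.disjoint_filter.2 fun b _ hb => ?_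
    rw [Fin.ext_iff]
    omega

theorem rank_lt_rank {a b : Fin I.n} (ha : a ∈ I.Aplus) (hab : a < b) :
    I.rank a < I.rank b := by
  have h := I.rank_succ a
  rw [if_pos ha] at h
  have := I.rank_mono (show a.val + 1 ≤ b.val from hab)
  omega

theorem rank_lt_card {a : Fin I.n} (ha : a ∈ I.Aplus) : I.rank a < I.Aplus.card := by
  have h := I.rank_succ a
  rw [if_pos ha] at h
  have := I.rank_mono (show a.val + 1 ≤ I.n from a.2)
  rw [rank_n] at this
  omega

theorem rank_injOn : Set.InjOn (fun a : Fin I.n => I.rank a) I.Aplus := by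
  intro a ha b hb h
  rcases lt_trichotomy a b with hab | hab | hab
  · exact absurd h (I.rank_lt_rank ha hab).ne
  · exact hab
  · exact absurd h (I.rank_lt_rank hb hab).ne'

theorem exists_rank_eq {i : ℕ} (hi : i < I.Aplus.card) : ∃ a ∈ I.Aplus, I.rank a = i := by
  have h : I.Aplus.image (fun a : Fin I.n => I.rank a) = Finset.range I.Aplus.card := by
    refine Finset.eq_of_subset_of_card_le (fun j hj => ?_) ?_
    · obtain ⟨a, ha, rfl⟩ := Finset.mem_image.1 hj
      exact Finset.mem_range.2 (I.rank_lt_card ha)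
    · rw [Finset.card_image_of_injOn I.rank_injOn, Finset.card_range]
  have := Finset.mem_range.2 hi
  rwa [← h, Finset.mem_image] at this

/-- The bit mask of `{a} ∩ A⁺`; the mask of a subset of `A⁺` has the bits at the ranks of its
elements. -/
def bit (a : Fin I.n) : ℕ := if a ∈ I.Aplus then 2 ^ I.rank a else 0

/-! ### Links, their costs, and soundness of relaxation. -/

/-- The pairs that have to be positive for the link from `u` to `a`; here `none` stands for an
additional root whose links lead to the start agents. -/
def Link : Option (Fin I.n) → Fin I.n → Fin I.n → Prop
  | none, b, a => StartPair lib b a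
  | some u, b, _ => b = u

open Classical in
/-- The cost of establishing the link from `u` to `a`. -/
noncomputable def weight (u : Option (Fin I.n)) (a : Fin I.n) : ℕ :=
  ∑ b, if I.Link lib u b a ∧ I.φ b a = false then I.ρ b a else 0

theorem weight_some (b a : Fin I.n) :
    I.weight lib (some b) a = if I.φ b a = true then 0 else I.ρ b a := by
  classical
  rw [weight, Finset.sum_eq_single b]
  · cases h : I.φ b a <;> simp [Link]
  · exact fun c _ hc => if_neg fun h => hc h.1
  · simp

/-- The agents that are reachable from `u` under the profile `ψ`. -/
def reach (ψ : Profile (Fin I.n)) : Option (Fin I.n) → Set (Fin I.n)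
  | none => startRule lib ψ
  | some u => {a | Relation.ReflTransGen (fun b c => ψ b c = true) u a}

/-- Additional positive qualifications never hurt, which is what allows extensions to be joined. -/
theorem reach_mono {ψ ψ' : Profile (Fin I.n)} (h : ∀ a b, ψ a b = true → ψ' a b = true)
    (u : Option (Fin I.n)) : I.reach lib ψ u ⊆ I.reach lib ψ' u := by
  cases u with
  | none =>
    refine Set.iUnion_mono fun i => ?_
    induction i with
    | zero => exact fun a ha b hb => h b a (ha b hb)
    | succ i ih => exact fun a ⟨b, hb, hba⟩ => ⟨b, ih hb, h b a hba⟩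
  | some u => exact fun a ha => Relation.ReflTransGen.mono (fun b c => h b c) _ _ ha

theorem reach_some_subset {ψ : Profile (Fin I.n)} {u : Option (Fin I.n)} {v : Fin I.n}
    (h : ∀ b, I.Link lib u b v → ψ b v = true) :
    I.reach lib ψ (some v) ⊆ I.reach lib ψ u := by
  cases u with
  | none =>
    intro a ha
    induction ha with
    | refl => exact Set.mem_iUnion.2 ⟨0, h⟩
    | tail _ hbc ih => exact mem_iterationResult_of_rel ih hbc
  | some u => exact fun a ha => Relation.ReflTransGen.head (h u rfl) ha

/-- Some extension of the given profile of cost at most `c` makes all agents of `A⁺` with bits in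
the mask `S` reachable from `u`. -/
def Achieves (u : Option (Fin I.n)) (S c : ℕ) : Prop :=
  ∃ ψ : Profile (Fin I.n), (∀ a b, I.φ a b = true → ψ a b = true) ∧ I.cost ψ ≤ c ∧
    ∀ a ∈ I.Aplus, S.testBit (I.rank a) = true → a ∈ I.reach lib ψ u

theorem achieves_zero (u : Option (Fin I.n)) : I.Achieves lib u 0 0 :=
  ⟨I.φ, fun _ _ h => h, by simp [cost], by simp⟩

theorem achieves_bit (a : Fin I.n) : I.Achieves lib (some a) (I.bit a) 0 := by
  refine ⟨I.φ, fun _ _ h => h, by simp [cost], fun b hb h => ?_⟩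
  rw [bit] at h
  split_ifs at h with ha
  · rw [Nat.testBit_two_pow, decide_eq_true_eq] at h
    rw [I.rank_injOn ha hb h]
    exact Relation.ReflTransGen.refl
  · simp at h

variable {I lib}

/-- Take the union of both extensions and the pairs of the link. Each added pair is already paid for
in one of the three, so costs are subadditive. -/
theorem Achieves.link {u : Option (Fin I.n)} {v : Fin I.n} {S S' c c' : ℕ}
    (h : I.Achieves lib u S c) (h' : I.Achieves lib (some v) S' c') :
    I.Achieves lib u (S ||| S') (c + c' + I.weight lib u v) := by
  classical
  obtain ⟨ψ, h1, h2, h3⟩ := h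
  obtain ⟨ψ', h1', h2', h3'⟩ := h'
  set χ : Profile (Fin I.n) := fun b a =>
    ψ b a || ψ' b a || decide (a = v ∧ I.Link lib u b v) with hχ
  refine ⟨χ, fun a b hab => by simp [hχ, h1 a b hab], ?_, fun a ha hS => ?_⟩
  · refine le_trans ?_ (Nat.add_le_add_right (Nat.add_le_add h2 h2') _)
    have hw : I.weight lib u v = ∑ p : Fin I.n × Fin I.n,
        if p.2 = v ∧ I.Link lib u p.1 v ∧ I.φ p.1 p.2 = false then I.ρ p.1 p.2 else 0 := by
      rw [Fintype.sum_prod_type, weight]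
      refine Finset.sum_congr rfl fun b _ => ?_
      rw [Finset.sum_eq_single v]
      · simp
      · exact fun a _ ha => if_neg fun h => ha h.1
      · simp
    rw [hw, cost, cost, cost, ← Finset.sum_add_distrib, ← Finset.sum_add_distrib]
    refine Finset.sum_le_sum fun p _ => ?_
    have e1 := h1 p.1 p.2
    have e2 := h1' p.1 p.2
    -- A pair of the link is charged to the weight, any other pair to `ψ` or `ψ'`.
    by_cases hl : p.2 = v ∧ I.Link lib u p.1 v
    · have : (if χ p.1 p.2 ≠ I.φ p.1 p.2 then I.ρ p.1 p.2 else 0) ≤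
          if p.2 = v ∧ I.Link lib u p.1 v ∧ I.φ p.1 p.2 = false then I.ρ p.1 p.2 else 0 := by
        cases hφ : I.φ p.1 p.2
        · simp only [hl, and_self, if_true]
          split_ifs <;> simp
        · simp [hχ, e1 hφ]
      omega
    · have : χ p.1 p.2 = (ψ p.1 p.2 || ψ' p.1 p.2) := by
        simp only [hχ, hl, decide_false, Bool.or_false]
      rw [this]
      refine le_trans ?_ (Nat.le_add_right _ _)
      revert e1 e2
      cases I.φ p.1 p.2 <;> cases ψ p.1 p.2 <;> cases ψ' p.1 p.2 <;> simp
  · rw [Nat.testBit_or, Bool.or_eq_true] at hS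
    rcases hS with hS | hS
    · exact I.reach_mono lib (fun b c hbc => by simp [hχ, hbc]) u (h3 a ha hS)
    · refine I.reach_some_subset lib (v := v) (fun b hb => by simp [hχ, hb]) ?_
      exact I.reach_mono lib (fun b c hbc => by simp [hχ, hbc]) _ (h3' a ha hS)

theorem Achieves.isYes {c : ℕ} (h : I.Achieves lib none (2 ^ I.Aplus.card - 1) c)
    (hc : c ≤ I.budget) : I.IsYes (startRule lib) := by
  obtain ⟨ψ, _, h2, h3⟩ := h
  refine ⟨ψ, h2.trans hc, fun a ha => h3 a ha ?_⟩
  rw [Nat.testBit_two_pow_sub_one]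
  simpa using I.rank_lt_card ha

/-! ### Completeness: extracting a tree from a profile and contracting it. -/

variable (I) in
/-- The cost of the modifications of `φ` that concern qualifications of `a`. -/
def columnCost (ψ : Profile (Fin I.n)) (a : Fin I.n) : ℕ :=
  ∑ b, if ψ b a ≠ I.φ b a then I.ρ b a else 0

theorem sum_columnCost (ψ : Profile (Fin I.n)) : ∑ a, I.columnCost ψ a = I.cost ψ := by
  rw [cost, Fintype.sum_prod_type_right]
  rfl

/-- The link is charged to the column of its target alone, so links with different targets never
compete for the same modifications. -/
theorem weight_le_columnCost {ψ : Profile (Fin I.n)} {u : Option (Fin I.n)} {a : Fin I.n}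
    (h : ∀ b, I.Link lib u b a → ψ b a = true) : I.weight lib u a ≤ I.columnCost ψ a := by
  classical
  refine Finset.sum_le_sum fun b _ => ?_
  split_ifs with h1 h2
  · exact le_rfl
  · exact absurd (h b h1.1) (by rw [not_not] at h2; rw [h2, h1.2]; simp)
  · exact Nat.zero_le _
  · exact le_rfl

/-- The agents qualified under a profile form a forest all of whose links are paid for. -/
theorem exists_forest (lib : Bool) (ψ : Profile (Fin I.n)) :
    ∃ r : Option (Fin I.n) → ℕ, ∀ a ∈ startRule lib ψ, ∃ u : Option (Fin I.n),
      (∀ b, u = some b → b ∈ startRule lib ψ) ∧ r u < r (some a) ∧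
        I.weight lib u a ≤ I.columnCost ψ a := by
  classical
  set K : Set (Fin I.n) := {a | ∀ b, StartPair lib b a → ψ b a = true} with hK
  -- The root gets `0` and an agent one more than its first stage. Agents of stage `0` hang from the
  -- root, others from an agent of the preceding stage.
  refine ⟨fun u => u.elim 0 fun a => sInf {i | a ∈ stage ψ K i} + 1, fun a ha => ?_⟩
  have hne : {i | a ∈ stage ψ K i}.Nonempty := Set.mem_iUnion.1 ha
  have hmem : a ∈ stage ψ K (sInf {i | a ∈ stage ψ K i}) := Nat.sInf_mem hne
  rcases h : sInf {i | a ∈ stage ψ K i} with _ | i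
  · rw [h] at hmem
    exact ⟨none, by simp, by simp, weight_le_columnCost hmem⟩
  · rw [h] at hmem
    obtain ⟨b, hb, hba⟩ := hmem
    refine ⟨some b, ?_, ?_, weight_le_columnCost ?_⟩
    · rintro _ ⟨⟩
      exact Set.mem_iUnion.2 ⟨i, hb⟩
    · have : sInf {i | b ∈ stage ψ K i} ≤ i := Nat.sInf_le hb
      simp only [Option.elim, h]
      omega
    · rintro c rfl
      exact hba

variable (I lib) in
/-- One round of relaxations leads from table `T` to a table below `T'`. -/
def Relaxed (T T' : Option (Fin I.n) → ℕ → ℕ) : Prop :=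
  (∀ u, ∀ S < 2 ^ I.Aplus.card, T' u S ≤ T u S) ∧
    ∀ S < 2 ^ I.Aplus.card, ∀ S' < 2 ^ I.Aplus.card, ∀ u v,
      T' u (S ||| S') ≤ T u S + T (some v) S' + I.weight lib u v

variable (I) in
/-- Progress towards cost `c` after `j` rounds: masks at some agents of `X` and at the root cover
`A⁺`, and the table entries for these masks and the costs `w` of the remaining agents add up to at
most `c`. The remaining agents form an initial segment of `X` with respect to `r`. -/
def Progress (X : Set (Fin I.n)) (r : Option (Fin I.n) → ℕ) (w : Fin I.n → ℕ) (c j : ℕ)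
    (T : Option (Fin I.n) → ℕ → ℕ) : Prop :=
  ∃ (Q : Finset (Option (Fin I.n))) (m : Option (Fin I.n) → ℕ),
    none ∈ Q ∧ Q.card ≤ I.n - j + 1 ∧ (∀ a, some a ∈ Q → a ∈ X) ∧
    (∀ a, some a ∈ Q → ∀ b ∈ X, r (some b) < r (some a) → some b ∈ Q) ∧
    (∀ u, m u < 2 ^ I.Aplus.card) ∧
    (∀ i < I.Aplus.card, ∃ u ∈ Q, (m u).testBit i = true) ∧
    ∑ u ∈ Q, (T u (m u) + u.elim 0 w) ≤ c

theorem bit_lt (a : Fin I.n) : I.bit a < 2 ^ I.Aplus.card := by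
  rw [bit]
  split_ifs with h
  · exact Nat.pow_lt_pow_right (by norm_num) (I.rank_lt_card h)
  · positivity

/-- Initially the root and all agents of `X` remain, each agent covering just its own bit. The table
entries vanish, and the column costs add up to at most the cost of `ψ`. -/
theorem progress_zero {ψ : Profile (Fin I.n)} {X : Set (Fin I.n)} (hX : ∀ a ∈ I.Aplus, a ∈ X)
    (r : Option (Fin I.n) → ℕ) {T : Option (Fin I.n) → ℕ → ℕ} (h0 : T none 0 = 0)
    (hb : ∀ a, T (some a) (I.bit a) = 0) :
    I.Progress X r (I.columnCost ψ) (I.cost ψ) 0 T := by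
  classical
  refine ⟨Finset.univ.filter fun u => ∀ a, u = some a → a ∈ X, fun u => u.elim 0 I.bit,
    by simp, ?_, by simp, ?_, ?_, ?_, ?_⟩
  · exact (Finset.card_le_univ _).trans (by simp)
  · intro a _ b hb _
    simpa using hb
  · rintro (_ | a)
    · simp
    · exact bit_lt a
  · intro i hi
    obtain ⟨a, ha, rfl⟩ := I.exists_rank_eq hi
    refine ⟨some a, by simpa using hX a ha, ?_⟩
    simp [bit, ha]
  · rw [← sum_columnCost]
    refine (Finset.sum_le_sum_of_subset (Finset.filter_subset _ _)).trans ?_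
    rw [Fintype.sum_option]
    simp [h0, hb]

/-- The remaining agent `a` with the largest value of `r` is contracted: its mask moves to its
parent, and the summand `w a` thereby released pays for the link. -/
theorem Progress.relaxed {X : Set (Fin I.n)} {r : Option (Fin I.n) → ℕ} {w : Fin I.n → ℕ}
    {c j : ℕ} {T T' : Option (Fin I.n) → ℕ → ℕ} (h : I.Progress X r w c j T)
    (hT : I.Relaxed lib T T')
    (hX : ∀ a ∈ X, ∃ u : Option (Fin I.n), (∀ b, u = some b → b ∈ X) ∧ r u < r (some a) ∧
      I.weight lib u a ≤ w a) : I.Progress X r w c (j + 1) T' := by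
  classical
  obtain ⟨Q, m, h1, h2, h3, h4, h5, h6, h7⟩ := h
  -- With only the root left there is nothing to contract, and the entries merely decrease.
  rcases (Q.erase none).eq_empty_or_nonempty with hQ | hQ
  · have hQ' : Q = {none} := by
      rw [← Finset.insert_erase h1, hQ]
      rfl
    refine ⟨Q, m, h1, by simp [hQ'], h3, h4, h5, h6,
      le_trans (Finset.sum_le_sum fun u _ => ?_) h7⟩
    exact Nat.add_le_add_right (hT.1 u _ (h5 u)) _
  · obtain ⟨u, hu, hmax⟩ := Finset.exists_max_image (Q.erase none) r hQ
    rw [Finset.mem_erase] at hu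
    obtain ⟨a, rfl⟩ := Option.ne_none_iff_exists'.1 hu.1
    obtain ⟨u, hu1, hu2, hu3⟩ := hX a (h3 a hu.2)
    have huQ : u ∈ Q.erase (some a) := by
      rw [Finset.mem_erase]
      refine ⟨fun e => by simp [e] at hu2, ?_⟩
      rcases u with _ | b
      · exact h1
      · exact h4 a hu.2 b (hu1 b rfl) hu2
    refine ⟨Q.erase (some a), Function.update m u (m u ||| m (some a)), by simp [h1], ?_, ?_, ?_,
      ?_, ?_, ?_⟩
    · have := Finset.card_pos.2 ⟨_, Finset.mem_erase.2 ⟨Ne.symm hu.1, h1⟩⟩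
      rw [Finset.card_erase_of_mem hu.2] at this ⊢
      omega
    · exact fun b hb => h3 b (Finset.mem_of_mem_erase hb)
    · intro b hb d hd hdb
      have hb' := Finset.mem_of_mem_erase hb
      refine Finset.mem_erase.2 ⟨?_, h4 b hb' d hd hdb⟩
      rintro ⟨⟩
      exact absurd (hmax (some b) (by simp [hb'])) (by omega)
    · intro v
      rw [Function.update_apply]
      split_ifs
      · exact Nat.or_lt_two_pow (h5 _) (h5 _)
      · exact h5 v
    · intro i hi
      obtain ⟨v, hv, hvi⟩ := h6 i hi
      by_cases hva : v = some a
      · refine ⟨u, huQ, ?_⟩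
        rw [hva] at hvi
        simp [hvi]
      · refine ⟨v, Finset.mem_erase.2 ⟨hva, hv⟩, ?_⟩
        rw [Function.update_apply]
        split_ifs with hvu
        · rw [hvu] at hvi
          simp [hvi]
        · exact hvi
    · refine le_trans ?_ h7
      -- Isolate the summands of `a` and of its parent `u`; one relaxation compares these, and the
      -- others do not increase.
      rw [← Finset.add_sum_erase _ _ huQ, ← Finset.add_sum_erase _ _ hu.2,
        ← Finset.add_sum_erase _ (fun u => T u (m u) + u.elim 0 w) huQ, Function.update_self]
      have hrest : ∑ v ∈ (Q.erase (some a)).erase u,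
            (T' v (Function.update m u (m u ||| m (some a)) v) + v.elim 0 w) ≤
          ∑ v ∈ (Q.erase (some a)).erase u, (T v (m v) + v.elim 0 w) := by
        refine Finset.sum_le_sum fun v hv => Nat.add_le_add_right ?_ _
        rw [Function.update_of_ne (Finset.ne_of_mem_erase hv)]
        exact hT.1 v _ (h5 v)
      have := hT.2 _ (h5 u) _ (h5 (some a)) u a
      simp only [Option.elim_some]
      omega

/-- After `n` rounds at most one vertex remains. It is the root, whose mask must then contain every
bit. -/
theorem Progress.table_le {X : Set (Fin I.n)} {r : Option (Fin I.n) → ℕ} {w : Fin I.n → ℕ}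
    {c : ℕ} {T : Option (Fin I.n) → ℕ → ℕ} (h : I.Progress X r w c I.n T) :
    T none (2 ^ I.Aplus.card - 1) ≤ c := by
  obtain ⟨Q, m, h1, h2, -, -, h5, h6, h7⟩ := h
  have hQ : Q = {none} := by
    refine (Finset.eq_of_subset_of_card_le (Finset.singleton_subset_iff.2 h1) ?_).symm
    simpa using h2
  subst hQ
  have : m none = 2 ^ I.Aplus.card - 1 := by
    refine Nat.eq_of_testBit_eq fun i => ?_
    rw [Nat.testBit_two_pow_sub_one]
    by_cases hi : i < I.Aplus.card
    · simpa [hi] using h6 i hi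
    · simp only [hi, decide_false]
      exact Nat.testBit_lt_two_pow ((h5 none).trans_le
        (Nat.pow_le_pow_right (by norm_num) (not_lt.1 hi)))
  simpa [this] using h7

end LinkBriberyInstance

/-! ## The program -/

namespace LinkBriberyInstance

variable (I : LinkBriberyInstance)

theorem encode_getD_zero : I.encode.getD 0 0 = I.n := by simp [encode]

theorem encode_getD_one : I.encode.getD 1 0 = I.budget := by simp [encode]

theorem mul_add_lt {n : ℕ} (u v : Fin n) : u.val * n + v.val < n * n := by
  have := Nat.mul_le_mul_right n (show u.val + 1 ≤ n from u.2)
  have := v.2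
  rw [add_mul] at *
  omega

theorem encode_getD_profile (u v : Fin I.n) :
    I.encode.getD (2 + (u * I.n + v)) 0 = (I.φ u v).toNat := by
  have h := mul_add_lt u v
  have h1 : (⟨u * I.n + v, h⟩ : Fin (I.n * I.n)).divNat = u := by
    ext
    simp [Fin.divNat, mul_comm _ I.n, Nat.mul_add_div (Fin.pos u)]
  have h2 : (⟨u * I.n + v, h⟩ : Fin (I.n * I.n)).modNat = v := by
    ext
    simp [Fin.modNat, Nat.mod_eq_of_lt v.2]
  simp [encode, List.getD_eq_getElem?_getD, List.getElem?_append, add_comm 2, h, h1, h2]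

theorem encode_getD_price (u v : Fin I.n) :
    I.encode.getD (2 + I.n * I.n + (u * I.n + v)) 0 = I.ρ u v := by
  have h := mul_add_lt u v
  have h1 : (⟨u * I.n + v, h⟩ : Fin (I.n * I.n)).divNat = u := by
    ext
    simp [Fin.divNat, mul_comm _ I.n, Nat.mul_add_div (Fin.pos u)]
  have h2 : (⟨u * I.n + v, h⟩ : Fin (I.n * I.n)).modNat = v := by
    ext
    simp [Fin.modNat, Nat.mod_eq_of_lt v.2]
  rw [show 2 + I.n * I.n + (u * I.n + v) = I.n * I.n + (u * I.n + v) + 2 by omega]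
  simp [encode, List.getD_eq_getElem?_getD, List.getElem?_append, h, h1, h2]

theorem encode_getD_mem (a : Fin I.n) :
    I.encode.getD (2 + (I.n * I.n + I.n * I.n) + a) 0 = if a ∈ I.Aplus then 1 else 0 := by
  rw [show 2 + (I.n * I.n + I.n * I.n) + a.val = I.n * I.n + I.n * I.n + a + 2 by omega]
  have h : ¬ I.n * I.n + I.n * I.n + a.val < I.n * I.n := by omega
  have h' : I.n * I.n + I.n * I.n + a.val - I.n * I.n = I.n * I.n + a.val := by omega
  simp [encode, List.getD_eq_getElem?_getD, List.getElem?_append, h, h']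

/-- Each number adds at least its separator to the size, and the two leading numbers and the
indicator sequence already give `n + 2` numbers. -/
theorem n_add_two_le_inputSize : I.n + 2 ≤ inputSize I.encode := by
  have h1 : ∀ l : List ℕ, l.length ≤ inputSize l := by
    intro l
    induction l with
    | nil => simp
    | cons a l ih =>
      simp only [inputSize, List.map_cons, List.sum_cons, List.length_cons] at *
      omega
  refine le_trans ?_ (h1 _)
  simp [encode]
  omega

end LinkBriberyInstance

namespace LoopLang

/-- The value of `min a b`. -/
def Exp.min (a b : Exp) : Exp := .sub a (.sub a b)

/-- `0` if `a = b`. -/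
def Exp.ne (a b : Exp) : Exp := .add (.sub a b) (.sub b a)

@[simp] theorem Exp.eval_min (inp : List ℕ) (s : State) (a b : Exp) :
    (Exp.min a b).eval inp s = Min.min (a.eval inp s) (b.eval inp s) := by
  simp only [Exp.min, eval]
  omega

theorem Exp.eval_ne_eq_zero (inp : List ℕ) (s : State) (a b : Exp) :
    (Exp.ne a b).eval inp s = 0 ↔ a.eval inp s = b.eval inp s := by
  simp only [Exp.ne, eval]
  omega

end LoopLang

/-! The variables of the program are
* `0`: the result; `1`: the number `n` of agents; `2`: the budget; `3`: `2 ^ |A⁺|`; `4`: `|A⁺|`;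
  `5`: `n + 1`; `6`: `n * n`; `7`: multiples of `2 ^ |A⁺|`;
* `8` – `14`: loop counters, among them the masks `11`, `12` and the vertices `13`, `14`;
* `15`: an accumulator, and later the union of two masks; `16` – `18`: auxiliary values.

The arrays are `0`: the multiples of `n`; `1`: the masks of single agents; `2`: the matrix of the
costs of links; `3`: the multiples of `2 ^ |A⁺|`; `4`: the table of the dynamic program. -/

namespace LinkBriberyProgram

open LoopLang LinkBriberyInstance

/-- Read the numbers at the front of the input. -/
def header : Cmd :=
  .seq (.assign 1 (.inp (.lit 0))) <| .seq (.assign 2 (.inp (.lit 1))) <|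
    .seq (.assign 3 (.lit 1)) <| .assign 5 (.add (.var 1) (.lit 1))

/-- Multiples of `n`. -/
def rows : Cmd :=
  .seq (.loop 8 1 <| .seq (.store 0 (.var 8) (.var 6)) (.assign 6 (.add (.var 6) (.var 1))))
    -- The loop ends before `n`, but the root has row `n` and needs its offset too.
    (.store 0 (.var 1) (.var 6))

/-- The mask of the agent `8`. -/
def bitStep : Cmd :=
  .seq (.assign 15 (.inp (.add (.add (.lit 2) (.add (.var 6) (.var 6))) (.var 8)))) <|
  .seq (.store 1 (.var 8) (.cond (.var 15) (.var 3) (.lit 0))) <|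
  .seq (.assign 4 (.add (.var 4) (.var 15)))
    -- Doubling at every agent of `A⁺` makes this variable the next free bit and, at the end, the
    -- number of masks.
    (.assign 3 (.cond (.var 15) (.add (.var 3) (.var 3)) (.var 3)))

/-- Masks of single agents. -/
def bits : Cmd := .loop 8 1 bitStep

/-- The cost of the link from agent `8` to agent `9`. -/
def linkStep : Cmd :=
  .store 2 (.add (.arr 0 (.var 8)) (.var 9))
    (.cond (.inp (.add (.lit 2) (.add (.arr 0 (.var 8)) (.var 9)))) (.lit 0)
      (.inp (.add (.add (.lit 2) (.var 6)) (.add (.arr 0 (.var 8)) (.var 9)))))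

/-- Costs of links between agents. -/
def links : Cmd := .loop 8 1 (.loop 9 1 linkStep)

/-- Whether the pair of the agents `8` and `9` matters for agent `9` being a start agent. -/
def guard : Bool → Exp
  | true => .cond (.ne (.var 8) (.var 9)) (.lit 0) (.lit 1)
  | false => .lit 1

/-- The contribution of the pair of the agents `8` and `9` to the link from the root to `9`. -/
def rootAdd (lib : Bool) : Cmd :=
  .assign 15 (.add (.var 15)
    (.cond (guard lib) (.arr 2 (.add (.arr 0 (.var 8)) (.var 9))) (.lit 0)))

/-- The cost of the link from the root to agent `9`. -/
def rootStep (lib : Bool) : Cmd :=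
  .seq (.assign 15 (.lit 0)) <|
    -- Variable `6` holds `n * n`, the offset of the root's row in the matrix of link costs.
    .seq (.loop 8 1 (rootAdd lib)) (.store 2 (.add (.var 6) (.var 9)) (.var 15))

/-- Costs of links from the root. -/
def rootLinks (lib : Bool) : Cmd := .loop 9 1 (rootStep lib)

/-- Multiples of `2 ^ |A⁺|`. -/
def tableRows : Cmd :=
  .loop 8 5 <| .seq (.store 3 (.var 8) (.var 7)) (.assign 7 (.add (.var 7) (.var 3)))

/-- Initial values of the table. -/
def initTable : Cmd :=
  .loop 8 5 <| .loop 9 3 <| .store 4 (.add (.arr 3 (.var 8)) (.var 9))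
    -- The value `budget + 1` serves as infinity. Array `1` is `0` at the root's position `n`, so
    -- there only the empty mask starts with a finite entry.
    (.cond (.var 9) (.cond (.ne (.var 9) (.arr 1 (.var 8))) (.add (.var 2) (.lit 1)) (.lit 0))
      (.lit 0))

/-- The parity of an expression. -/
def parity (e : Exp) : Exp := .sub e (.add (.half e) (.half e))

/-- The union of the masks `11` and `12`. -/
def union : Cmd :=
  .seq (.assign 15 (.lit 0)) <| .seq (.assign 16 (.lit 1)) <|
    .seq (.assign 17 (.var 11)) <| .seq (.assign 18 (.var 12)) <| .loop 8 4 <|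
      .seq (.assign 15 (.add (.var 15)
        (.cond (.add (parity (.var 17)) (parity (.var 18))) (.var 16) (.lit 0)))) <|
      .seq (.assign 16 (.add (.var 16) (.var 16))) <|
      .seq (.assign 17 (.half (.var 17))) (.assign 18 (.half (.var 18)))

/-- Relaxation of the table entry for vertex `13` and mask `15` along the link to vertex `14`. -/
def relax : Cmd :=
  .store 4 (.add (.arr 3 (.var 13)) (.var 15))
    (.min (.arr 4 (.add (.arr 3 (.var 13)) (.var 15)))
      (.add (.add (.arr 4 (.add (.arr 3 (.var 13)) (.var 11)))
          (.arr 4 (.add (.arr 3 (.var 14)) (.var 12))))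
        (.arr 2 (.add (.arr 0 (.var 13)) (.var 14)))))

/-- Relaxations along all links for the masks `11` and `12`. -/
def relaxLinks : Cmd := .loop 13 5 (.loop 14 1 relax)

/-- One round of relaxations. -/
def round : Cmd := .loop 11 3 (.loop 12 3 (.seq union relaxLinks))

/-- Comparison with the budget. -/
def answer : Cmd :=
  .assign 0 (.cond (.sub (.arr 4 (.add (.arr 3 (.var 1)) (.sub (.var 3) (.lit 1)))) (.var 2))
    (.lit 0) (.lit 1))

/-- The part of the program with loops of length `n`. -/
def prepare (lib : Bool) : Cmd := .seq rows (.seq bits (.seq links (rootLinks lib)))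

/-- The dynamic program. -/
def solve : Cmd := .seq tableRows (.seq initTable (.seq (.loop 10 1 round) answer))

/-- The program for priced constructive link bribery. -/
def main (lib : Bool) : Cmd := .seq header (.seq (prepare lib) solve)

/-- Distinct matrix cells have distinct addresses, so a store changes only one entry. -/
theorem mul_add_inj {n u v u' v' : ℕ} (hv : v < n) (hv' : v' < n)
    (h : u * n + v = u' * n + v') : u = u' ∧ v = v' := by
  have hu : u = u' := by
    have h1 : (u * n + v) / n = u := by
      rw [mul_comm, Nat.mul_add_div (by omega), Nat.div_eq_of_lt hv, add_zero]
    have h2 : (u' * n + v') / n = u' := by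
      rw [mul_comm, Nat.mul_add_div (by omega), Nat.div_eq_of_lt hv', add_zero]
    rw [← h1, h, h2]
  subst hu
  omega

/-! ### Correctness of the tables computed from the input. -/

section Prepare

variable {I : LinkBriberyInstance} {s : State}

theorem rows_spec (h1 : s.v 1 = I.n) (h6 : s.v 6 = 0) :
    (rows.eval I.encode s).v 6 = I.n * I.n ∧
      ∀ u ≤ I.n, (rows.eval I.encode s).h 0 u = u * I.n := by
  obtain ⟨e1, e6, e0⟩ := Cmd.eval_loop_induction I.encode 8 1
    (.seq (.store 0 (.var 8) (.var 6)) (.assign 6 (.add (.var 6) (.var 1)))) s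
    (fun i t => t.v 1 = I.n ∧ t.v 6 = i * I.n ∧ ∀ u < i, t.h 0 u = u * I.n)
    ⟨h1, by simpa using h6, by simp⟩
    (by
      rintro i hi t ⟨t1, t6, t0⟩
      simp only [Cmd.eval, Exp.eval, State.set_v, State.put_v, State.set_h, State.put_h]
      refine ⟨by simpa using t1, by simp [t1, t6, add_mul], fun u hu => ?_⟩
      by_cases hui : u = i
      · simp [hui, t6]
      · simp [hui, t0 u (by omega)])
    (fun t ht => by simpa [State.set_v] using ht)
  rw [h1] at e6 e0
  rw [rows, Cmd.eval, Cmd.eval]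
  simp only [Exp.eval, State.put_v, State.put_h, e1, e6]
  refine ⟨trivial, fun u hu => ?_⟩
  by_cases hun : u = I.n
  · simp [hun]
  · simp [hun, e0 u (by omega)]

theorem bits_spec (h1 : s.v 1 = I.n) (h3 : s.v 3 = 1) (h4 : s.v 4 = 0)
    (h6 : s.v 6 = I.n * I.n) (hz : ∀ i, s.h 1 i = 0) :
    (bits.eval I.encode s).v 3 = 2 ^ I.Aplus.card ∧
      (bits.eval I.encode s).v 4 = I.Aplus.card ∧
      (∀ a : Fin I.n, (bits.eval I.encode s).h 1 a = I.bit a) ∧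
      (bits.eval I.encode s).h 1 I.n = 0 := by
  obtain ⟨e3, e4, e6, ea, e0⟩ := Cmd.eval_loop_induction I.encode 8 1 bitStep s
    (fun i t => t.v 3 = 2 ^ I.rank i ∧ t.v 4 = I.rank i ∧ t.v 6 = I.n * I.n ∧
      -- The clause on positions from `i` on preserves the `0` at position `n`, the mask of the
      -- root.
      (∀ a : Fin I.n, a.val < i → t.h 1 a = I.bit a) ∧ ∀ j ≥ i, t.h 1 j = 0)
    ⟨by simpa [rank_zero] using h3, by simpa [rank_zero] using h4, h6, by simp,
      fun j _ => hz j⟩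
    (by
      rintro i hi t ⟨t3, t4, t6, ta, t0⟩
      rw [h1] at hi
      have hr := I.rank_succ ⟨i, hi⟩
      have hm := I.encode_getD_mem ⟨i, hi⟩
      simp only [bitStep, Cmd.eval, Exp.eval, State.set_v, State.put_v, State.set_h, State.put_h]
      simp only [if_true, t3, t4, t6, hm, Nat.reduceEqDiff, if_false, hr]
      refine ⟨?_, ?_, trivial, fun a ha => ?_, fun j hj => ?_⟩
      · split_ifs with h <;> simp_all [pow_succ, mul_two]
      · trivial
      · by_cases hai : a.val = i
        · subst hai
          simp [bit]
        · simp [hai, ta a (by omega)]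
      · rw [if_neg (by omega), t0 j (by omega)])
    (fun t ht => by simpa [State.set_v] using ht)
  rw [h1] at e3 e4 ea e0
  rw [rank_n] at e3 e4
  exact ⟨e3, e4, fun a => ea a a.2, e0 _ le_rfl⟩

theorem links_spec (lib : Bool) (h1 : s.v 1 = I.n) (h6 : s.v 6 = I.n * I.n)
    (h0 : ∀ u ≤ I.n, s.h 0 u = u * I.n) (u v : Fin I.n) :
    (links.eval I.encode s).h 2 (u * I.n + v) = I.weight lib (some u) v := by
  obtain ⟨-, -, -, e⟩ := Cmd.eval_loop_induction I.encode 8 1 (.loop 9 1 linkStep) s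
    (fun i t => t.v 1 = I.n ∧ t.v 6 = I.n * I.n ∧ (∀ u ≤ I.n, t.h 0 u = u * I.n) ∧
      ∀ u v : Fin I.n, u.val < i → t.h 2 (u * I.n + v) = I.weight lib (some u) v)
    ⟨h1, h6, h0, by simp⟩
    (by
      rintro i hi t ⟨t1, t6, t0, t2⟩
      rw [h1] at hi
      obtain ⟨e1, -, e6, e0, e2, e3⟩ := Cmd.eval_loop_induction I.encode 9 1 linkStep (t.set 8 i)
        (fun j t => t.v 1 = I.n ∧ t.v 8 = i ∧ t.v 6 = I.n * I.n ∧
          (∀ u ≤ I.n, t.h 0 u = u * I.n) ∧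
          (∀ u v : Fin I.n, u.val < i → t.h 2 (u * I.n + v) = I.weight lib (some u) v) ∧
          ∀ v : Fin I.n, v.val < j → t.h 2 (i * I.n + v) = I.weight lib (some ⟨i, hi⟩) v)
        ⟨by simpa [State.set_v] using t1, by simp [State.set_v], by simpa [State.set_v] using t6,
          t0, t2, by simp⟩
        (by
          rintro j hj t ⟨t1, t8, t6, t0, t2, t3⟩
          rw [State.set_v, if_neg (by decide), ‹(_ : State).v 1 = I.n›] at hj
          have hp := I.encode_getD_profile ⟨i, hi⟩ ⟨j, hj⟩
          have hq := I.encode_getD_price ⟨i, hi⟩ ⟨j, hj⟩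
          have h0i := t0 i hi.le
          simp only [linkStep, Cmd.eval, Exp.eval, State.set_v, State.put_v, State.set_h,
            State.put_h]
          simp only [if_true, t1, t8, t6, h0i, Nat.reduceEqDiff, if_false,
            hp, hq]
          refine ⟨trivial, trivial, trivial, fun u hu => ?_, fun u v hu => ?_, fun v hv => ?_⟩
          · simp [t0 u hu]
          · rw [if_neg, t2 u v hu]
            rintro ⟨-, h⟩
            exact hu.ne (mul_add_inj v.2 hj h).1
          · by_cases hvj : v.val = j
            · subst hvj
              rw [if_pos ⟨trivial, rfl⟩, weight_some]
              cases I.φ ⟨i, hi⟩ v <;> simp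
            · rw [if_neg (by omega), t3 v (by omega)])
        (fun t ht => by simpa [State.set_v] using ht)
      refine ⟨e1, e6, e0, fun u v hu => ?_⟩
      rcases Nat.lt_succ_iff_lt_or_eq.1 hu with hu | hu
      · exact e2 u v hu
      · subst hu
        exact e3 v (by rw [State.set_v, if_neg (by decide), t1]; exact v.2))
    (fun t ht => by simpa [State.set_v] using ht)
  exact e u v (by rw [h1]; exact u.2)

theorem eval_guard_eq_zero (lib : Bool) (inp : List ℕ) (t : State) {n : ℕ} (u v : Fin n)
    (hu : t.v 8 = u) (hv : t.v 9 = v) : (guard lib).eval inp t = 0 ↔ ¬ StartPair lib u v := by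
  cases lib with
  | false => simp [guard, Exp.eval, StartPair]
  | true =>
    have := Exp.eval_ne_eq_zero inp t (.var 8) (.var 9)
    simp only [Exp.eval, hu, hv, ← Fin.ext_iff] at this
    simp only [guard, Exp.eval, this, StartPair]
    split_ifs with h <;> simp [h]

theorem rootLinks_spec (lib : Bool) (h1 : s.v 1 = I.n) (h6 : s.v 6 = I.n * I.n)
    (h0 : ∀ u ≤ I.n, s.h 0 u = u * I.n)
    (h2 : ∀ u v : Fin I.n, s.h 2 (u * I.n + v) = I.weight lib (some u) v)
    (u : Option (Fin I.n)) (v : Fin I.n) :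
    ((rootLinks lib).eval I.encode s).h 2 (u.elim I.n (↑) * I.n + v) = I.weight lib u v := by
  classical
  obtain ⟨-, -, -, e2, e⟩ := Cmd.eval_loop_induction I.encode 9 1 (rootStep lib) s
    (fun i t => t.v 1 = I.n ∧ t.v 6 = I.n * I.n ∧ (∀ u ≤ I.n, t.h 0 u = u * I.n) ∧
      (∀ u v : Fin I.n, t.h 2 (u * I.n + v) = I.weight lib (some u) v) ∧
      ∀ v : Fin I.n, v.val < i → t.h 2 (I.n * I.n + v) = I.weight lib none v)
    ⟨h1, h6, h0, h2, by simp⟩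
    (by
      rintro i hi t ⟨t1, t6, t0, t2, t3⟩
      rw [h1] at hi
      -- The summands of the root weight, extended by `0` to all numbers, so that the accumulator is
      -- a sum over an initial range.
      set F : ℕ → ℕ := fun u => if hu : u < I.n then
        if StartPair lib (A := Fin I.n) ⟨u, hu⟩ ⟨i, hi⟩ ∧ I.φ ⟨u, hu⟩ ⟨i, hi⟩ = false then
          I.ρ ⟨u, hu⟩ ⟨i, hi⟩ else 0 else 0 with hF
      have hsum : I.weight lib none ⟨i, hi⟩ = ∑ u ∈ Finset.range I.n, F u := by
        rw [Finset.sum_range]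
        exact Finset.sum_congr rfl fun u _ => by simp [hF, Link]; congr
      obtain ⟨e1, e9, e6, eh, e15⟩ := Cmd.eval_loop_induction I.encode 8 1 (rootAdd lib)
        ((Cmd.assign 15 (.lit 0)).eval I.encode (t.set 9 i))
        (fun j t' => t'.v 1 = I.n ∧ t'.v 9 = i ∧ t'.v 6 = I.n * I.n ∧ t'.h = t.h ∧
          t'.v 15 = ∑ u ∈ Finset.range j, F u)
        ⟨by simpa [Cmd.eval, State.set_v] using t1, by simp [Cmd.eval, State.set_v],
          by simpa [Cmd.eval, State.set_v] using t6, by simp [Cmd.eval],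
          by simp [Cmd.eval, Exp.eval, State.set_v]⟩
        (by
          rintro j hj t' ⟨t1', t9, t6', th, t15⟩
          have hj' : j < I.n := by simpa [Cmd.eval, State.set_v, t1] using hj
          have hg := eval_guard_eq_zero lib I.encode (t'.set 8 j) ⟨j, hj'⟩ ⟨i, hi⟩
            (by simp [State.set_v]) (by simpa [State.set_v] using t9)
          have hw := t2 ⟨j, hj'⟩ ⟨i, hi⟩
          rw [weight_some] at hw
          simp only [rootAdd, Cmd.eval, Exp.eval, State.set_v, State.set_h, hg, th]
          simp only [if_true, t1', t9, t6', t0 j hj'.le, Nat.reduceEqDiff,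
            if_false, hw, t15, Finset.sum_range_succ, true_and]
          congr 1
          simp only [hF, dif_pos hj']
          by_cases hS : StartPair lib (A := Fin I.n) ⟨j, hj'⟩ ⟨i, hi⟩ <;>
            cases I.φ ⟨j, hj'⟩ ⟨i, hi⟩ <;> simp [hS])
        (fun t ht => by simpa [State.set_v] using ht)
      rw [show ((Cmd.assign 15 (.lit 0)).eval I.encode (t.set 9 i)).v 1 = I.n by
        simpa [Cmd.eval, State.set_v] using t1, ← hsum] at e15
      generalize hr : (Cmd.loop 8 1 (rootAdd lib)).eval I.encode
        ((Cmd.assign 15 (.lit 0)).eval I.encode (t.set 9 i)) = r at e1 e9 e6 eh e15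
      have hstep : (rootStep lib).eval I.encode (t.set 9 i) =
          r.put 2 (r.v 6 + r.v 9) (r.v 15) := by
        rw [← hr]
        rfl
      rw [hstep]
      simp only [State.put_v, State.put_h, e1, e6, e9, e15, eh]
      refine ⟨trivial, trivial, fun u hu => by simp [t0 u hu], fun u v => ?_, fun v hv => ?_⟩
      · rw [if_neg, t2]
        rintro ⟨-, h⟩
        exact u.2.ne (mul_add_inj v.2 hi h).1
      · by_cases hvi : v.val = i
        · subst hvi
          simp
        · rw [if_neg (by omega), t3 v (by omega)])
    (fun t ht => by simpa [State.set_v] using ht)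
  cases u with
  | none => exact e v (by rw [h1]; exact v.2)
  | some u => exact e2 u v

end Prepare

end LinkBriberyProgram

namespace LinkBriberyProgram

open LoopLang LinkBriberyInstance

/-! ### The state handed over to the dynamic program. -/

/-- The row of a vertex in the tables. -/
abbrev row {n : ℕ} (u : Option (Fin n)) : ℕ := u.elim n (↑)

theorem row_le {n : ℕ} (u : Option (Fin n)) : row u ≤ n := by
  cases u with
  | none => exact le_rfl
  | some u => exact u.2.le

theorem row_injective {n : ℕ} : Function.Injective (row (n := n)) := by
  rintro (_ | u) (_ | v) h
  · rfl
  · exact absurd h v.2.ne'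
  · exact absurd h u.2.ne
  · exact congrArg some (Fin.ext h)

theorem exists_row_eq {n i : ℕ} (hi : i < n + 1) : ∃ u : Option (Fin n), row u = i := by
  rcases Nat.lt_succ_iff_lt_or_eq.1 hi with h | rfl
  · exact ⟨some ⟨i, h⟩, rfl⟩
  · exact ⟨none, rfl⟩

/-- The data of the instance are available in the variables and arrays. -/
structure Prepared (I : LinkBriberyInstance) (lib : Bool) (s : State) : Prop where
  v1 : s.v 1 = I.n
  v2 : s.v 2 = I.budget
  v3 : s.v 3 = 2 ^ I.Aplus.card
  v4 : s.v 4 = I.Aplus.card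
  v5 : s.v 5 = I.n + 1
  h0 : ∀ u ≤ I.n, s.h 0 u = u * I.n
  h1 : ∀ u : Option (Fin I.n), s.h 1 (row u) = u.elim 0 I.bit
  h2 : ∀ (u : Option (Fin I.n)) (v : Fin I.n), s.h 2 (row u * I.n + v) = I.weight lib u v

variable {I : LinkBriberyInstance} {lib : Bool} {s : State}

theorem Prepared.congr {t : State} (h : Prepared I lib s)
    (hv : ∀ x ∈ Finset.Icc 1 5, t.v x = s.v x) (h0 : t.h 0 = s.h 0) (h1 : t.h 1 = s.h 1)
    (h2 : t.h 2 = s.h 2) : Prepared I lib t where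
  v1 := (hv 1 (by decide)).trans h.v1
  v2 := (hv 2 (by decide)).trans h.v2
  v3 := (hv 3 (by decide)).trans h.v3
  v4 := (hv 4 (by decide)).trans h.v4
  v5 := (hv 5 (by decide)).trans h.v5
  h0 := by rw [h0]; exact h.h0
  h1 := by rw [h1]; exact h.h1
  h2 := by rw [h2]; exact h.h2

theorem Prepared.eval {inp : List ℕ} (h : Prepared I lib s) (c : Cmd)
    (hw : ∀ x ∈ Finset.Icc 1 5, x ∉ c.writes)
    (hs : ∀ j ∈ ({0, 1, 2} : Finset (Fin 5)), j ∉ c.stores) : Prepared I lib (c.eval inp s) :=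
  h.congr (fun x hx => c.eval_v_of_notMem_writes inp s x (hw x hx))
    (c.eval_h_of_notMem_stores inp s 0 (hs 0 (by decide)))
    (c.eval_h_of_notMem_stores inp s 1 (hs 1 (by decide)))
    (c.eval_h_of_notMem_stores inp s 2 (hs 2 (by decide)))

theorem Prepared.set (h : Prepared I lib s) {x : ℕ} (hx : x ∉ Finset.Icc 1 5) (a : ℕ) :
    Prepared I lib (s.set x a) :=
  h.congr (fun y hy => by rw [State.set_v, if_neg]; rintro rfl; exact hx hy) rfl rfl rfl

theorem prepared_prepare (lib : Bool) :
    Prepared I lib ((prepare lib).eval I.encode (header.eval I.encode State.zero)) ∧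
      ((prepare lib).eval I.encode (header.eval I.encode State.zero)).v 7 = 0 := by
  set s0 := header.eval I.encode State.zero with hs0
  have z1 : s0.v 1 = I.n := I.encode_getD_zero
  have z2 : s0.v 2 = I.budget := I.encode_getD_one
  have z3 : s0.v 3 = 1 := rfl
  have z4 : s0.v 4 = 0 := rfl
  have z5 : s0.v 5 = I.n + 1 := congrArg (· + 1) I.encode_getD_zero
  have z6 : s0.v 6 = 0 := rfl
  have z7 : s0.v 7 = 0 := rfl
  have zh : ∀ i, s0.h 1 i = 0 := fun i => rfl
  clear_value s0
  rw [prepare, Cmd.eval, Cmd.eval, Cmd.eval]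
  have fr : ∀ x ∉ rows.writes, (rows.eval I.encode s0).v x = s0.v x := fun x hx =>
    rows.eval_v_of_notMem_writes _ _ x hx
  have fh := rows.eval_h_of_notMem_stores I.encode s0
  obtain ⟨a6, a0⟩ := rows_spec z1 z6
  set s1 := rows.eval I.encode s0
  clear_value s1
  have fr1 : ∀ x ∉ bits.writes, (bits.eval I.encode s1).v x = s1.v x := fun x hx =>
    bits.eval_v_of_notMem_writes _ _ x hx
  have fh1 := bits.eval_h_of_notMem_stores I.encode s1
  obtain ⟨b3, b4, b1, b1'⟩ := bits_spec (s := s1) ((fr 1 (by decide)).trans z1)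
    ((fr 3 (by decide)).trans z3) ((fr 4 (by decide)).trans z4) a6
    (fun i => by rw [fh 1 (by decide), zh])
  set s2 := bits.eval I.encode s1
  clear_value s2
  have fr2 : ∀ x ∉ links.writes, (links.eval I.encode s2).v x = s2.v x := fun x hx =>
    links.eval_v_of_notMem_writes _ _ x hx
  have fh2 := links.eval_h_of_notMem_stores I.encode s2
  have c1 : s2.v 1 = I.n := by rw [fr1 1 (by decide), fr 1 (by decide), z1]
  have c6 : s2.v 6 = I.n * I.n := by rw [fr1 6 (by decide), a6]
  have c0 : ∀ u ≤ I.n, s2.h 0 u = u * I.n := by rw [fh1 0 (by decide)]; exact a0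
  have d2 := links_spec lib c1 c6 c0
  set s3 := links.eval I.encode s2
  clear_value s3
  -- The two rules differ only in an expression, hence change the same variables and arrays.
  have hw : ∀ x, x ∉ (rootLinks true).writes → x ∉ (rootLinks lib).writes := by
    cases lib <;> exact fun x hx => hx
  have hst : ∀ x, x ∉ (rootLinks true).stores → x ∉ (rootLinks lib).stores := by
    cases lib <;> exact fun x hx => hx
  have fr3 : ∀ x ∉ (rootLinks true).writes, ((rootLinks lib).eval I.encode s3).v x = s3.v x :=
    fun x hx => (rootLinks lib).eval_v_of_notMem_writes _ _ x (hw x hx)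
  have fh3 : ∀ j ∉ (rootLinks true).stores, ((rootLinks lib).eval I.encode s3).h j = s3.h j :=
    fun j hj => (rootLinks lib).eval_h_of_notMem_stores I.encode s3 j (hst j hj)
  have e0 : ∀ u ≤ I.n, s3.h 0 u = u * I.n := by rw [fh2 0 (by decide)]; exact c0
  have e2 := rootLinks_spec lib (s := s3) ((fr2 1 (by decide)).trans c1)
    ((fr2 6 (by decide)).trans c6) e0 d2
  refine ⟨⟨?_, ?_, ?_, ?_, ?_, ?_, ?_, e2⟩, ?_⟩
  · rw [fr3 1 (by decide), fr2 1 (by decide), c1]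
  · rw [fr3 2 (by decide), fr2 2 (by decide), fr1 2 (by decide), fr 2 (by decide), z2]
  · rw [fr3 3 (by decide), fr2 3 (by decide), b3]
  · rw [fr3 4 (by decide), fr2 4 (by decide), b4]
  · rw [fr3 5 (by decide), fr2 5 (by decide), fr1 5 (by decide), fr 5 (by decide), z5]
  · rw [fh3 0 (by decide)]
    exact e0
  · rw [fh3 1 (by decide), fh2 1 (by decide)]
    rintro (_ | u)
    · exact b1'
    · exact b1 u
  · rw [fr3 7 (by decide), fr2 7 (by decide), fr1 7 (by decide), fr 7 (by decide), z7]

/-- In addition, the rows of the dynamic program are available. -/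
structure Ready (I : LinkBriberyInstance) (lib : Bool) (s : State) : Prop
    extends Prepared I lib s where
  h3 : ∀ u ≤ I.n, s.h 3 u = u * 2 ^ I.Aplus.card

theorem Ready.eval {inp : List ℕ} (h : Ready I lib s) (c : Cmd)
    (hw : ∀ x ∈ Finset.Icc 1 5, x ∉ c.writes)
    (hs : ∀ j ∈ ({0, 1, 2, 3} : Finset (Fin 5)), j ∉ c.stores) : Ready I lib (c.eval inp s) where
  toPrepared := h.toPrepared.eval c hw fun j hj => hs j (by revert hj; revert j; decide)
  h3 := by
    rw [c.eval_h_of_notMem_stores inp s 3 (hs 3 (by decide))]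
    exact h.h3

theorem Ready.set (h : Ready I lib s) {x : ℕ} (hx : x ∉ Finset.Icc 1 5) (a : ℕ) :
    Ready I lib (s.set x a) := ⟨h.toPrepared.set hx a, h.h3⟩

theorem tableRows_spec {inp : List ℕ} (h : Prepared I lib s) (h7 : s.v 7 = 0) :
    Ready I lib (tableRows.eval inp s) := by
  refine ⟨h.eval tableRows (by decide) (by decide), ?_⟩
  obtain ⟨-, -, e⟩ := Cmd.eval_loop_induction inp 8 5
    (.seq (.store 3 (.var 8) (.var 7)) (.assign 7 (.add (.var 7) (.var 3)))) s
    (fun i t => t.v 3 = 2 ^ I.Aplus.card ∧ t.v 7 = i * 2 ^ I.Aplus.card ∧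
      ∀ u < i, t.h 3 u = u * 2 ^ I.Aplus.card)
    ⟨h.v3, by simpa using h7, by simp⟩
    (by
      rintro i hi t ⟨t1, t6, t0⟩
      simp only [Cmd.eval, Exp.eval, State.set_v, State.put_v, State.set_h, State.put_h]
      refine ⟨by simpa using t1, by simp [t1, t6, add_mul], fun u hu => ?_⟩
      by_cases hui : u = i
      · simp [hui, t6]
      · simp [hui, t0 u (by omega)])
    (fun t ht => by simpa [State.set_v] using ht)
  rw [h.v5] at e
  exact fun u hu => e u (by omega)

/-! ### The table, its initial values, and unions of masks. -/

/-- The table of the dynamic program, read off from its array. -/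
def table (I : LinkBriberyInstance) (H : ℕ → ℕ) (u : Option (Fin I.n)) (S : ℕ) : ℕ :=
  H (row u * 2 ^ I.Aplus.card + S)

theorem table_update (H : ℕ → ℕ) (a : ℕ) (u u' : Option (Fin I.n)) {S S' : ℕ}
    (hS : S < 2 ^ I.Aplus.card) (hS' : S' < 2 ^ I.Aplus.card) :
    table I (Function.update H (row u * 2 ^ I.Aplus.card + S) a) u' S' =
      if u' = u ∧ S' = S then a else table I H u' S' := by
  rw [table, Function.update_apply]
  refine if_congr ⟨fun h => ?_, fun h => by rw [h.1, h.2]⟩ rfl rfl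
  obtain ⟨h1, h2⟩ := mul_add_inj hS' hS h
  exact ⟨row_injective h1, h2⟩

theorem initTable_spec {inp : List ℕ} (h : Ready I lib s) (u : Option (Fin I.n)) {S : ℕ}
    (hS : S < 2 ^ I.Aplus.card) :
    table I ((initTable.eval inp s).h 4) u S =
      if S = 0 then 0 else if S = u.elim 0 I.bit then 0 else I.budget + 1 := by
  obtain ⟨-, e⟩ := Cmd.eval_loop_induction inp 8 5
    (.loop 9 3 <| .store 4 (.add (.arr 3 (.var 8)) (.var 9))
    (.cond (.var 9) (.cond (.ne (.var 9) (.arr 1 (.var 8))) (.add (.var 2) (.lit 1)) (.lit 0))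
      (.lit 0))) s
    (fun i t => Ready I lib t ∧ ∀ u : Option (Fin I.n), row u < i → ∀ S < 2 ^ I.Aplus.card,
      table I (t.h 4) u S =
        if S = 0 then 0 else if S = u.elim 0 I.bit then 0 else I.budget + 1)
    ⟨h, by simp⟩
    (by
      rintro i hi t ⟨t1, t2⟩
      rw [h.v5] at hi
      obtain ⟨u, rfl⟩ := exists_row_eq hi
      obtain ⟨e1, -, e2, e3⟩ := Cmd.eval_loop_induction inp 9 3
        (.store 4 (.add (.arr 3 (.var 8)) (.var 9))
        (.cond (.var 9) (.cond (.ne (.var 9) (.arr 1 (.var 8))) (.add (.var 2) (.lit 1)) (.lit 0))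
          (.lit 0))) (t.set 8 (row u))
        (fun j t => Ready I lib t ∧ t.v 8 = row u ∧
          (∀ u' : Option (Fin I.n), row u' < row u → ∀ S < 2 ^ I.Aplus.card,
            table I (t.h 4) u' S =
              if S = 0 then 0 else if S = u'.elim 0 I.bit then 0 else I.budget + 1) ∧
          ∀ S < j, table I (t.h 4) u S =
              if S = 0 then 0 else if S = u.elim 0 I.bit then 0 else I.budget + 1)
        ⟨t1.set (by decide) _, by simp [State.set_v], t2, by simp⟩
        (by
          rintro j hj t ⟨t1, t8, t2, t3⟩
          rw [State.set_v, if_neg (by decide), ‹Ready I lib (_ : State)›.v3] at hj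
          have hne := Exp.eval_ne_eq_zero inp (t.set 9 j) (.var 9) (.arr 1 (.var 8))
          have hstep : ((Cmd.store 4 (.add (.arr 3 (.var 8)) (.var 9))
            (.cond (.var 9) (.cond (.ne (.var 9) (.arr 1 (.var 8))) (.add (.var 2) (.lit 1))
              (.lit 0)) (.lit 0))).eval inp (t.set 9 j)).h 4 =
              Function.update (t.h 4) (row u * 2 ^ I.Aplus.card + j)
                (if j = 0 then 0 else if j = u.elim 0 I.bit then 0 else I.budget + 1) := by
            simp only [Exp.eval, State.set_v, State.set_h, t8] at hne
            simp only [Cmd.eval, Exp.eval, State.put, State.set_v, State.set_h, t8]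
            simp [t1.v2, t1.h3 _ (row_le u), t1.h1 u, hne]
          refine ⟨(t1.set (by decide) _).eval _ (by decide) (by decide),
            by simpa [Cmd.eval, State.set_v] using t8, fun u' hu' S hS => ?_, fun S hS => ?_⟩
          · rw [hstep, table_update _ _ _ _ hj hS, if_neg, t2 u' hu' S hS]
            rintro ⟨rfl, -⟩
            exact hu'.false
          · rw [hstep, table_update _ _ _ _ hj (by omega)]
            by_cases hSj : S = j
            · simp [hSj]
            · rw [if_neg (by tauto), t3 S (by omega)])
        (fun t ht => ⟨ht.1.set (by decide) _, by simpa [State.set_v] using ht.2.1, ht.2.2⟩)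
      refine ⟨e1, fun u' hu' S hS => ?_⟩
      rcases Nat.lt_succ_iff_lt_or_eq.1 hu' with hu' | hu'
      · exact e2 u' hu' S hS
      · rw [row_injective hu']
        exact e3 S (by rw [State.set_v, if_neg (by decide), t1.v3]; exact hS))
    (fun t ht => ⟨ht.1.set (by decide) _, ht.2⟩)
  exact e u (by rw [h.v5]; exact Nat.lt_succ_of_le (row_le u)) S hS

theorem union_spec {inp : List ℕ} {k x y : ℕ} (h4 : s.v 4 = k) (h11 : s.v 11 = x)
    (h12 : s.v 12 = y) (hx : x < 2 ^ k) (hy : y < 2 ^ k) :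
    (union.eval inp s).v 15 = x ||| y := by
  obtain ⟨e15, -⟩ := Cmd.eval_loop_induction inp 8 4
    (.seq (.assign 15 (.add (.var 15)
        (.cond (.add (parity (.var 17)) (parity (.var 18))) (.var 16) (.lit 0)))) <|
      .seq (.assign 16 (.add (.var 16) (.var 16))) <|
      .seq (.assign 17 (.half (.var 17))) (.assign 18 (.half (.var 18))))
    ((Cmd.assign 18 (.var 12)).eval inp ((Cmd.assign 17 (.var 11)).eval inp
      ((Cmd.assign 16 (.lit 1)).eval inp ((Cmd.assign 15 (.lit 0)).eval inp s))))
    -- After `i` passes the accumulator holds the lowest `i` bits of the union, and both operands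
    -- have been shifted by `i`.
    (fun i t => t.v 15 = (x ||| y) % 2 ^ i ∧ t.v 16 = 2 ^ i ∧ t.v 17 = x / 2 ^ i ∧
      t.v 18 = y / 2 ^ i)
    (by simp [Cmd.eval, Exp.eval, State.set_v, h11, h12, Nat.mod_one])
    (by
      rintro i - t ⟨t15, t16, t17, t18⟩
      have hp : ∀ a : ℕ, a - (a / 2 + a / 2) = a % 2 := by omega
      simp only [Cmd.eval, parity, Exp.eval, State.set_v]
      simp only [if_true, Nat.reduceEqDiff, if_false, t15, t16, t17, t18, hp]
      refine ⟨?_, by rw [pow_succ, mul_two], by rw [Nat.div_div_eq_div_mul, pow_succ],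
        by rw [Nat.div_div_eq_div_mul, pow_succ]⟩
      rw [Nat.mod_pow_succ, ← Nat.toNat_testBit (x ||| y), Nat.testBit_or,
        Nat.testBit_eq_decide_div_mod_eq, Nat.testBit_eq_decide_div_mod_eq]
      rcases Nat.mod_two_eq_zero_or_one (x / 2 ^ i) with h1 | h1 <;>
        rcases Nat.mod_two_eq_zero_or_one (y / 2 ^ i) with h2 | h2 <;> simp [h1, h2])
    (fun t ht => by simpa [State.set_v] using ht)
  refine e15.trans ?_
  simp only [Cmd.eval, State.set_v, Nat.reduceEqDiff, if_false, h4]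
  exact Nat.mod_eq_of_lt (Nat.or_lt_two_pow hx hy)

/-! ### Correctness of the dynamic program. -/

/-- The finite table entries are costs of extensions of the profile. -/
def Sound (I : LinkBriberyInstance) (lib : Bool) (H : ℕ → ℕ) : Prop :=
  ∀ u, ∀ S < 2 ^ I.Aplus.card, table I H u S ≤ I.budget → I.Achieves lib u S (table I H u S)

/-- A rule for loops that decrease the entries of the table. -/
theorem eval_loop_forall {inp : List ℕ} {x y : ℕ} {c : Cmd} {s : State} (J : State → Prop)
    (Q : ℕ → (ℕ → ℕ) → Prop) (hJ : ∀ t a, J t → J (t.set x a))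
    (hQ : ∀ i H H', H' ≤ H → Q i H → Q i H') (h0 : J s)
    (hs : ∀ i < s.v y, ∀ t, J t → t.v x = i →
      J (c.eval inp t) ∧ (c.eval inp t).h 4 ≤ t.h 4 ∧ Q i ((c.eval inp t).h 4)) :
    J ((Cmd.loop x y c).eval inp s) ∧ ((Cmd.loop x y c).eval inp s).h 4 ≤ s.h 4 ∧
      ∀ i < s.v y, Q i (((Cmd.loop x y c).eval inp s).h 4) := by
  refine Cmd.eval_loop_induction inp x y c s
    (fun i t => J t ∧ t.h 4 ≤ s.h 4 ∧ ∀ j < i, Q j (t.h 4)) ⟨h0, le_rfl, by simp⟩ ?_ ?_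
  · rintro i hi t ⟨t1, t2, t3⟩
    obtain ⟨e1, e2, e3⟩ := hs i hi (t.set x i) (hJ t i t1) (by simp [State.set_v])
    refine ⟨e1, e2.trans t2, fun j hj => ?_⟩
    rcases Nat.lt_succ_iff_lt_or_eq.1 hj with hj | rfl
    · exact hQ j _ _ e2 (t3 j hj)
    · exact e3
  · rintro t ⟨t1, t2, t3⟩
    exact ⟨hJ t _ t1, t2, t3⟩

theorem relax_spec {inp : List ℕ} (h : Ready I lib s) (hs : Sound I lib (s.h 4)) {x y : ℕ}
    (hx : x < 2 ^ I.Aplus.card) (hy : y < 2 ^ I.Aplus.card) (u : Option (Fin I.n))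
    (v : Fin I.n) (h11 : s.v 11 = x) (h12 : s.v 12 = y) (h13 : s.v 13 = row u)
    (h14 : s.v 14 = v) (h15 : s.v 15 = x ||| y) :
    Sound I lib ((relax.eval inp s).h 4) ∧ (relax.eval inp s).h 4 ≤ s.h 4 ∧
      table I ((relax.eval inp s).h 4) u (x ||| y) ≤
        table I (s.h 4) u x + table I (s.h 4) (some v) y + I.weight lib u v := by
  have hxy := Nat.or_lt_two_pow hx hy
  have hstep : (relax.eval inp s).h 4 = Function.update (s.h 4)
      (row u * 2 ^ I.Aplus.card + (x ||| y)) (min (table I (s.h 4) u (x ||| y))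
        (table I (s.h 4) u x + table I (s.h 4) (some v) y + I.weight lib u v)) := by
    simp only [relax, Cmd.eval, State.put, Exp.eval, Exp.eval_min, h11, h12, h13, h14, h15,
      h.h3 _ (row_le u), h.h0 _ (row_le u), h.h3 _ v.2.le, h.h2, Function.update_self]
    rfl
  rw [hstep]
  refine ⟨fun u' S hS hb => ?_, fun i => ?_, ?_⟩
  · rw [table_update _ _ _ _ hxy hS] at hb ⊢
    by_cases hc : u' = u ∧ S = (x ||| y)
    · obtain ⟨rfl, rfl⟩ := hc
      rw [if_pos ⟨rfl, rfl⟩] at hb ⊢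
      rcases min_choice (table I (s.h 4) u' (x ||| y))
        (table I (s.h 4) u' x + table I (s.h 4) (some v) y + I.weight lib u' v) with e | e
      · rw [e] at hb ⊢
        exact hs _ _ hxy hb
      · rw [e] at hb ⊢
        -- A sum within the budget has both table summands within the budget, so neither stands for
        -- infinity and both are realised.
        exact (hs u' x hx (by omega)).link (hs (some v) y hy (by omega))
    · rw [if_neg hc] at hb ⊢
      exact hs u' S hS hb
  · rw [Function.update_apply]
    split_ifs with hi
    · rw [hi]
      exact min_le_left _ _
    · exact le_rfl
  · rw [table_update _ _ _ _ hxy hxy, if_pos ⟨rfl, rfl⟩]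
    exact min_le_right _ _

/-- The table is updated in place, so a relaxation may read entries already lowered in the same
round. This is harmless: entries never increase, so every inequality against the old table persists
once established. -/
theorem round_spec {inp : List ℕ} (h : Ready I lib s) (hs : Sound I lib (s.h 4)) :
    Ready I lib (round.eval inp s) ∧ Sound I lib ((round.eval inp s).h 4) ∧
      I.Relaxed lib (table I (s.h 4)) (table I ((round.eval inp s).h 4)) := by
  set H := s.h 4 with hH
  set Q : ℕ → ℕ → Option (Fin I.n) → Fin I.n → (ℕ → ℕ) → Prop := fun x y u v H' =>
    table I H' u (x ||| y) ≤ table I H u x + table I H (some v) y + I.weight lib u v with hQ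
  have hQm : ∀ x y u v H' H'', H'' ≤ H' → Q x y u v H' → Q x y u v H'' :=
    fun x y u v H' H'' hle hq => (hle _).trans hq
  set J : State → Prop := fun t => Ready I lib t ∧ Sound I lib (t.h 4) ∧ t.h 4 ≤ H with hJ
  have hJset : ∀ x ∉ Finset.Icc 1 5, ∀ t a, J t → J (t.set x a) :=
    fun x hx t a ht => ⟨ht.1.set hx a, ht.2⟩
  obtain ⟨e1, e2, e3⟩ := eval_loop_forall (inp := inp) (x := 11) (y := 3)
    (c := .loop 12 3 (.seq union relaxLinks)) (s := s) J
    (fun x H' => ∀ y < 2 ^ I.Aplus.card, ∀ i < I.n + 1, ∀ u, row u = i → ∀ j < I.n,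
      ∀ v : Fin I.n, v.val = j → Q x y u v H')
    (hJset 11 (by decide))
    (fun x H' H'' hle hq y hy i hi u hu j hj v hv =>
      hQm _ _ _ _ _ _ hle (hq y hy i hi u hu j hj v hv))
    ⟨h, hs, le_rfl⟩
    (by
      rintro x hx s1 j1 s11
      rw [h.v3] at hx
      obtain ⟨⟨e1, -⟩, e2, e3⟩ := eval_loop_forall (inp := inp) (x := 12) (y := 3)
        (c := .seq union relaxLinks) (s := s1) (fun t => J t ∧ t.v 11 = x)
        (fun y H' => ∀ i < I.n + 1, ∀ u, row u = i → ∀ j < I.n,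
          ∀ v : Fin I.n, v.val = j → Q x y u v H')
        (fun t a ht => ⟨hJset 12 (by decide) t a ht.1, by simpa [State.set_v] using ht.2⟩)
        (fun y H' H'' hle hq i hi u hu j hj v hv =>
          hQm _ _ _ _ _ _ hle (hq i hi u hu j hj v hv)) ⟨j1, s11⟩
        (by
          rintro y hy s2 ⟨j2, s11⟩ s12
          rw [j1.1.v3] at hy
          have u15 := union_spec (inp := inp) j2.1.v4 s11 s12 hx hy
          have u11 : (union.eval inp s2).v 11 = x := by
            rw [union.eval_v_of_notMem_writes _ _ _ (by decide), s11]
          have u12 : (union.eval inp s2).v 12 = y := by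
            rw [union.eval_v_of_notMem_writes _ _ _ (by decide), s12]
          have uh : (union.eval inp s2).h 4 = s2.h 4 :=
            union.eval_h_of_notMem_stores _ _ _ (by decide)
          have uj : J (union.eval inp s2) :=
            ⟨j2.1.eval union (by decide) (by decide), by rw [uh]; exact j2.2.1,
              by rw [uh]; exact j2.2.2⟩
          rw [Cmd.eval, ← uh]
          generalize union.eval inp s2 = s3 at *
          obtain ⟨⟨e1, e11, -⟩, e2, e3⟩ := eval_loop_forall (inp := inp) (x := 13) (y := 5)
            (c := .loop 14 1 relax) (s := s3)
            (fun t => J t ∧ t.v 11 = x ∧ t.v 12 = y ∧ t.v 15 = x ||| y)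
            (fun i H' => ∀ u, row u = i → ∀ j < I.n, ∀ v : Fin I.n, v.val = j → Q x y u v H')
            (fun t a ht => ⟨hJset 13 (by decide) t a ht.1, by simpa [State.set_v] using ht.2⟩)
            (fun i H' H'' hle hq u hu j hj v hv => hQm _ _ _ _ _ _ hle (hq u hu j hj v hv))
            ⟨uj, u11, u12, u15⟩
            (by
              rintro i hi s4 ⟨j4, k4⟩ s13
              rw [uj.1.v5] at hi
              obtain ⟨u, rfl⟩ := exists_row_eq hi
              obtain ⟨⟨e1, e11, -⟩, e2, e3⟩ := eval_loop_forall (inp := inp) (x := 14) (y := 1)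
                (c := relax) (s := s4)
                (fun t => J t ∧ (t.v 11 = x ∧ t.v 12 = y ∧ t.v 15 = x ||| y) ∧ t.v 13 = row u)
                (fun j H' => ∀ v : Fin I.n, v.val = j → Q x y u v H')
                (fun t a ht => ⟨hJset 14 (by decide) t a ht.1,
                  by simpa [State.set_v] using ht.2⟩)
                (fun j H' H'' hle hq v hv => hQm _ _ _ _ _ _ hle (hq v hv)) ⟨j4, k4, s13⟩
                (by
                  rintro j hj t ⟨⟨t1, t2, t3⟩, ⟨t11, t12, t15⟩, t13⟩ t14
                  rw [j4.1.v1] at hj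
                  obtain ⟨r1, r2, r3⟩ := relax_spec (inp := inp) t1 t2 hx hy u ⟨j, hj⟩ t11 t12
                    t13 t14 t15
                  refine ⟨⟨⟨t1.eval relax (by decide) (by decide), r1, r2.trans t3⟩,
                    ⟨t11, t12, t15⟩, t13⟩, r2, ?_⟩
                  rintro v rfl
                  refine r3.trans ?_
                  gcongr
                  · exact t3 _
                  · exact t3 _)
              refine ⟨⟨e1, e11⟩, e2, fun u' hu' j hj => ?_⟩
              rw [row_injective hu']
              exact e3 j (by rw [j4.1.v1]; exact hj))
          exact ⟨⟨e1, e11⟩, e2, fun i hi => e3 i (by rw [uj.1.v5]; exact hi)⟩)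
      exact ⟨e1, e2, fun y hy => e3 y (by rw [j1.1.v3]; exact hy)⟩)
  refine ⟨e1.1, e1.2.1, fun u S _ => e2 _, fun x hx y hy u v => ?_⟩
  exact e3 x (by rw [h.v3]; exact hx) y hy _ (Nat.lt_succ_of_le (row_le u)) u rfl _ v.2 v rfl

theorem solve_spec {inp : List ℕ} (h : Prepared I lib s) (h7 : s.v 7 = 0) :
    (I.IsYes (startRule lib) → (solve.eval inp s).v 0 = 1) ∧
      (¬ I.IsYes (startRule lib) → (solve.eval inp s).v 0 = 0) := by
  have h1 : Ready I lib (initTable.eval inp (tableRows.eval inp s)) :=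
    (tableRows_spec h h7).eval initTable (by decide) (by decide)
  have hinit := fun u S hS => initTable_spec (inp := inp) (tableRows_spec (inp := inp) h h7)
    u (S := S) hS
  rw [solve, Cmd.eval, Cmd.eval, Cmd.eval]
  generalize initTable.eval inp (tableRows.eval inp s) = s1 at *
  have hsound : Sound I lib (s1.h 4) := by
    intro u S hS hb
    rw [hinit u S hS] at hb ⊢
    split_ifs at hb ⊢ with hS0 hSu
    · rw [hS0]
      exact I.achieves_zero lib u
    · cases u with
      -- For the root, `hSu` says that the mask is empty.
      | none => exact absurd hSu hS0
      | some a =>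
        rw [hSu]
        exact I.achieves_bit lib a
    · omega
  -- The extra invariant `p` is `Progress` for yes-instances and trivial for no-instances, where
  -- soundness alone decides.
  have hloop : ∀ p : ℕ → (ℕ → ℕ) → Prop, p 0 (s1.h 4) →
      (∀ i H H', p i H → I.Relaxed lib (table I H) (table I H') → p (i + 1) H') →
      Ready I lib ((Cmd.loop 10 1 round).eval inp s1) ∧
        Sound I lib (((Cmd.loop 10 1 round).eval inp s1).h 4) ∧
        p I.n (((Cmd.loop 10 1 round).eval inp s1).h 4) := by
    intro p hp hstep
    rw [← h1.v1]
    refine Cmd.eval_loop_induction inp 10 1 round s1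
      (fun i t => Ready I lib t ∧ Sound I lib (t.h 4) ∧ p i (t.h 4)) ⟨h1, hsound, hp⟩ ?_ ?_
    · rintro i - t ⟨t1, t2, t3⟩
      obtain ⟨r1, r2, r3⟩ := round_spec (inp := inp) (s := t.set 10 i) (t1.set (by decide) i) t2
      exact ⟨r1, r2, hstep i _ _ t3 r3⟩
    · rintro t ⟨t1, t2⟩
      exact ⟨t1.set (by decide) _, t2⟩
  have hans : ∀ t, Ready I lib t → (answer.eval inp t).v 0 =
      if table I (t.h 4) none (2 ^ I.Aplus.card - 1) ≤ I.budget then 1 else 0 := by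
    intro t ht
    simp only [answer, Cmd.eval, Exp.eval, State.set_v, ht.v1, ht.v2, ht.v3, ht.h3 _ le_rfl,
      if_true, Nat.sub_eq_zero_iff_le]
    rfl
  constructor
  · rintro ⟨ψ, hc, hψ⟩
    -- The profile `ψ` may also remove qualifications; only the cost bounds of its forest are used.
    obtain ⟨r, hr⟩ := exists_forest lib ψ
    obtain ⟨l1, -, l3⟩ := hloop
      (fun i H => I.Progress (startRule lib ψ) r (I.columnCost ψ) (I.cost ψ) i (table I H))
      (progress_zero hψ r (by simp [hinit]) (fun a => by simp [hinit _ _ (bit_lt a)]))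
      (fun i H H' hp hrel => hp.relaxed hrel hr)
    rw [hans _ l1, if_pos (l3.table_le.trans hc)]
  · intro hno
    obtain ⟨l1, l2, -⟩ := hloop (fun _ _ => True) trivial (fun _ _ _ _ _ => trivial)
    rw [hans _ l1, if_neg]
    exact fun hle => hno ((l2 _ _ (by simp) hle).isYes hle)

/-! ### Running time and conclusion. -/

/-- The running time of the program, up to a polynomial in the size of the instance. -/
theorem exists_runs (lib : Bool) : ∃ C d : ℕ, ∀ I : LinkBriberyInstance,
    (main lib).Runs I.encode (C * (2 * 2 ^ I.Aplus.card) ^ d * inputSize I.encode ^ d)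
      State.zero := by
  refine ⟨header.coeff + ((prepare lib).coeff + solve.coeff), (prepare lib).deg + solve.deg,
    fun I => ?_⟩
  -- This exceeds or equals every loop limit: `n`, `n + 1`, `2 ^ |A⁺|` and `|A⁺|`.
  set M := 2 ^ I.Aplus.card + I.n + 1 with hM
  have hpow : 1 ≤ 2 ^ I.Aplus.card := Nat.one_le_two_pow
  obtain ⟨hp, -⟩ := prepared_prepare (I := I) lib
  have r1 : header.Runs I.encode (header.coeff * (M + 1) ^ header.deg) State.zero :=
    Cmd.runs (by decide) (by decide) (by simp [header, Cmd.bounds])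
  have r2 : (prepare lib).Runs I.encode ((prepare lib).coeff * (M + 1) ^ (prepare lib).deg)
      (header.eval I.encode State.zero) := by
    have hb : ∀ y ∈ (prepare lib).bounds, y = 1 := by cases lib <;> decide
    refine Cmd.runs (by cases lib <;> decide) (by cases lib <;> decide) fun y hy => ?_
    rw [hb y hy]
    have : (header.eval I.encode State.zero).v 1 = I.n := I.encode_getD_zero
    omega
  have r3 : solve.Runs I.encode (solve.coeff * (M + 1) ^ solve.deg)
      ((prepare lib).eval I.encode (header.eval I.encode State.zero)) := by
    have hb : ∀ y ∈ solve.bounds, y = 1 ∨ y = 3 ∨ y = 4 ∨ y = 5 := by decide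
    refine Cmd.runs (by decide) (by decide) fun y hy => ?_
    have := Nat.lt_two_pow_self (n := I.Aplus.card)
    rcases hb y hy with rfl | rfl | rfl | rfl
    · rw [hp.v1]; omega
    · rw [hp.v3]; omega
    · rw [hp.v4]; omega
    · rw [hp.v5]; omega
  have hM' : M + 1 ≤ 2 * 2 ^ I.Aplus.card * inputSize I.encode := by
    have := I.n_add_two_le_inputSize
    nlinarith
  have hle : ∀ e ≤ (prepare lib).deg + solve.deg,
      (M + 1) ^ e ≤ (2 * 2 ^ I.Aplus.card) ^ ((prepare lib).deg + solve.deg) *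
        inputSize I.encode ^ ((prepare lib).deg + solve.deg) := by
    intro e he
    rw [← mul_pow]
    exact (Nat.pow_le_pow_right (by omega) he).trans (Nat.pow_le_pow_left hM' _)
  intro P off m hc hm
  obtain ⟨m', ⟨t, ht, e⟩, hm'⟩ := (r1.seq (r2.seq r3)) hc hm
  refine ⟨m', ⟨t, ht.trans ?_, e⟩, hm'⟩
  rw [mul_assoc, add_mul, add_mul]
  gcongr
  · exact hle _ (Nat.zero_le _)
  · exact hle _ (Nat.le_add_right _ _)
  · exact hle _ (Nat.le_add_left _ _)

theorem main_spec (lib : Bool) (I : LinkBriberyInstance) :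
    (I.IsYes (startRule lib) → ((main lib).eval I.encode State.zero).v 0 = 1) ∧
      (¬ I.IsYes (startRule lib) → ((main lib).eval I.encode State.zero).v 0 = 0) := by
  obtain ⟨h1, h2⟩ := prepared_prepare (I := I) lib
  exact solve_spec h1 h2

end LinkBriberyProgram

/-- For both start sets, constructive link bribery is fixed-parameter tractable. -/
theorem fixedParameterTractable_startRule (lib : Bool) :
    FixedParameterTractable (constructiveLinkBribery (startRule lib)) := by
  obtain ⟨C, d, h⟩ := LinkBriberyProgram.exists_runs lib
  refine ⟨(LinkBriberyProgram.main lib).code 0, fun k => C * (2 * 2 ^ k) ^ d, d, ?_, fun I => ?_⟩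
  · refine Primrec.to_comp ?_
    have hpow : Primrec₂ fun a b : ℕ => a ^ b := Primrec₂.unpaired'.1 Nat.Primrec.pow
    exact Primrec.nat_mul.comp (.const C) (hpow.comp (Primrec.nat_mul.comp (.const 2)
      (hpow.comp (.const 2) .id)) (.const d))
  · obtain ⟨h1, h2⟩ := LinkBriberyProgram.main_spec lib I
    have hh := (h I).haltsWithin
    constructor
    · intro hy
      rw [h1 hy] at hh
      exact hh
    · intro hn
      rw [h2 hn] at hh
      exact hh

theorem mainTheorem4 :
    FixedParameterTractable (constructiveLinkBribery CSR) ∧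
      FixedParameterTractable (constructiveLinkBribery LSR) := by
  have h1 : (fun {A : Type} => startRule (A := A) false) = @CSR :=
    funext fun A => funext fun φ => startRule_false φ
  have h2 : (fun {A : Type} => startRule (A := A) true) = @LSR :=
    funext fun A => funext fun φ => startRule_true φ
  rw [← h1, ← h2]
  exact ⟨fixedParameterTractable_startRule false, fixedParameterTractable_startRule true⟩
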